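/- For $s\in\mathbb C$ write $s=\sigma+it$ with $\sigma,t\in\mathbb R$. Let $$\mathcal R(s)=\int_{0\swarrow1}\frac{x^{-s}e^{\pi i x^2}}{e^{\pi i x}-e^{-\pi i x}}\,dx$$ be Riemann's auxiliary function, where the path of integration is the line through $\tfrac12$ of direction $e^{\pi i/4}$, run through from upper right to lower left, and $x^{-s}$ has its principal value. Let $\chi(s)=2^s\pi^{s-1}\sin(\pi s/2)\,\Gamma(1-s)$ be the factor in the functional equation $\zeta(s)=\chi(s)\zeta(1-s)$, and let $\eta=\eta(s)$ be the square root $\eta=\sqrt{\frac{s-1}{2\pi i}}$ with $-\frac{\pi}{4}<\arg\eta<\frac{3\pi}{4}$ (defined for $s\notin[1,\infty)$); $\eta^{s-1}$ has its principal value. Let $G$ be the set of all $s\in\mathbb C$ with $$\sigma<0,\qquad |s-1|\ge 5408\pi,\qquad t\ge-\tfrac{99}{20}(1-\sigma),\qquad (1-\sigma)^2\ge225\pi t .$$ Then: 1. $G$ is a closed subset of $\mathbb C$. 2. There is a function $U$, holomorphic on a neighbourhood of $G$, such that for every $s\in G$ one has $|U(s)|<0.9$ and $$\mathcal R(s)=-\chi(s)\,\eta^{s-1}e^{-\pi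 i\eta^2}\,\frac{\sqrt2\,e^{3\pi i/8}\sin\pi\eta}{2\cos2\pi\eta}\,\bigl(1+U(s)\bigr).$$ 3. The zeros of $\mathcal R$ in $G$ are exactly the negative even integers $-2,-4,-6,\dots$ that lie in $G$ (the trivial zeros). 4. Every zero of $\mathcal R$ in $G$ is simple. -/

import Mathlib

noncomputable section

namespace RiemannAux

/-- The integrand `x^{-s} e^{π i x²} / (e^{π i x} - e^{-π i x})`, with the principal branch of
`x^{-s}`. -/
def integrand (s x : ℂ) : ℂ :=
  x ^ (-s) * Complex.exp (Real.pi * Complex.I * x ^ 2) /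
    (Complex.exp (Real.pi * Complex.I * x) - Complex.exp (-(Real.pi * Complex.I * x)))

/-- The line through `1/2` of slope `1`, parametrized by arc length from lower left to upper
right. It meets the real axis only at `1/2` and avoids the cut `(-∞, 0]`. -/
def path (u : ℝ) : ℂ :=
  1 / 2 + u * Complex.exp (Real.pi * Complex.I / 4)

/-- Riemann's auxiliary function
`R(s) = ∫_{0 ↙ 1} x^{-s} e^{π i x²} / (e^{π i x} - e^{-π i x}) dx`.
The line of integration is run through from upper right to lower left, against the orientation
of `path`, hence the minus sign. -/
def R (s : ℂ) : ℂ :=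
  -∫ u : ℝ, integrand s (path u) * Complex.exp (Real.pi * Complex.I / 4)

/-- The factor of the functional equation `ζ(s) = χ(s) ζ(1 - s)`,
`χ(s) = 2^s π^{s-1} sin(π s / 2) Γ(1 - s)`. -/
def chi (s : ℂ) : ℂ :=
  2 ^ s * (Real.pi : ℂ) ^ (s - 1) * Complex.sin (Real.pi * s / 2) * Complex.Gamma (1 - s)

/-- The square root `η` of `(s - 1) / (2 π i)` with `-π/4 < arg η < 3π/4`, for `s` off the ray
`[1, ∞)`; see `eta_sq` and `arg_eta`. -/
def eta (s : ℂ) : ℂ :=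
  Complex.exp (Real.pi * Complex.I / 4) * ((1 - s) / (2 * Real.pi)) ^ (1 / 2 : ℂ)

theorem eta_sq (s : ℂ) : eta s ^ 2 = (s - 1) / (2 * Real.pi * Complex.I) := by
  have h1 : Complex.exp (Real.pi * Complex.I / 4) ^ 2 = Complex.I := by
    have h : ((2 : ℕ) : ℂ) * (Real.pi * Complex.I / 4) = Real.pi / 2 * Complex.I := by
      push_cast
      ring
    rw [← Complex.exp_nat_mul, h, Complex.exp_pi_div_two_mul_I]
  have h2 : (((1 - s) / (2 * Real.pi)) ^ (1 / 2 : ℂ)) ^ 2 = (1 - s) / (2 * Real.pi) := by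
    rw [← Complex.cpow_nat_mul]
    norm_num
  have hpi : (Real.pi : ℂ) ≠ 0 := by exact_mod_cast Real.pi_ne_zero
  rw [eta, mul_pow, h1, h2]
  field_simp
  rw [Complex.I_sq]
  ring

theorem arg_eta (s : ℂ) (hs : 1 - s ∈ Complex.slitPlane) :
    -(Real.pi / 4) < (eta s).arg ∧ (eta s).arg < 3 * Real.pi / 4 := by
  have hpi := Real.pi_pos
  have hz : (1 - s) / (2 * Real.pi) ∈ Complex.slitPlane := by
    have h : (1 - s) / (2 * Real.pi) = (((2 * Real.pi)⁻¹ : ℝ) : ℂ) * (1 - s) := by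
      push_cast
      rw [div_eq_inv_mul]
    rw [h, Complex.mem_slitPlane_iff_arg, Complex.arg_real_mul _ (by positivity)]
    rw [Complex.mem_slitPlane_iff_arg] at hs
    refine ⟨hs.1, mul_ne_zero ?_ hs.2⟩
    exact_mod_cast (by positivity : (2 * Real.pi)⁻¹ ≠ 0)
  set z := (1 - s) / (2 * Real.pi) with hzdef
  rw [Complex.mem_slitPlane_iff_arg] at hz
  have h1 : -Real.pi < z.arg := Complex.neg_pi_lt_arg z
  have h2 : z.arg < Real.pi := lt_of_le_of_ne (Complex.arg_le_pi z) hz.1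
  have key : (eta s).arg = Real.pi / 4 + z.arg / 2 := by
    have e : eta s = Complex.exp (Real.pi * Complex.I / 4 + Complex.log z * (1 / 2)) := by
      rw [Complex.exp_add, eta, ← hzdef, Complex.cpow_def_of_ne_zero hz.2]
    have him : (Real.pi * Complex.I / 4 + Complex.log z * (1 / 2)).im
        = Real.pi / 4 + z.arg / 2 := by
      have : (Real.pi * Complex.I / 4 + Complex.log z * (1 / 2))
          = ((1 / 2 : ℝ) : ℂ) * Complex.log z + ((Real.pi / 4 : ℝ) : ℂ) * Complex.I := by
        push_cast
        ring
      rw [this, Complex.add_im, Complex.im_ofReal_mul,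
        Complex.log_im, Complex.im_ofReal_mul, Complex.I_im]
      ring
    rw [e, Complex.arg_exp, him, toIocMod_eq_self]
    constructor <;> linarith
  rw [key]
  constructor <;> linarith

/-- The set `G`: `σ < 0`, `|s - 1| ≥ 5408 π`, `t ≥ -(99/20)(1 - σ)` and `(1 - σ)² ≥ 225 π t`,
where `s = σ + i t`. -/
def G : Set ℂ :=
  {s | s.re < 0 ∧ 5408 * Real.pi ≤ ‖s - 1‖ ∧ -(99 / 20) * (1 - s.re) ≤ s.im ∧
    225 * Real.pi * s.im ≤ (1 - s.re) ^ 2}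

/-- The main term
`-χ(s) η^{s-1} e^{-π i η²} · √2 e^{3 π i / 8} sin(π η) / (2 cos(2 π η))`. -/
def mainTerm (s : ℂ) : ℂ :=
  -chi s * eta s ^ (s - 1) * Complex.exp (-(Real.pi * Complex.I * eta s ^ 2)) *
    ((Real.sqrt 2 : ℂ) * Complex.exp (3 * Real.pi * Complex.I / 8) *
        Complex.sin (Real.pi * eta s) /
      (2 * Complex.cos (2 * Real.pi * eta s)))

end RiemannAux

end

/-!
For `s.re < -1` the pole of `1 / sin (π x)` at `x = 0` is cancelled by `x ^ (-s)`, so the path of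
integration can be moved to the parallel line through `0`. Its two halves differ only by the branch
of `x ^ (-s)`, and `R s` becomes `sin (π s / 2)`, up to a factor without zeros, times the Mellin
transform at `1 - s` of `rayKernel v = e^{π i x²} / sin (π x)`, `x = e^{π i / 4} v`. The sine
produces the trivial zeros, and it remains to show that the Mellin factor is close to its main term.

Expanding `1 / sin (π x)` in powers of `e^{2 π i x}` turns the Mellin transform into a `Γ`-factor
times the sum over `k` of the integrals of `w ^ (s - 1) e^{π w² - 2 π κ w}` along vertical lines,
with `κ = (k + 1 / 2) e^{-π i / 4}`. For `k = 0` the line through the point `η e^{-π i / 4}`, which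
is almost a saddle point, gives a Gaussian integral up to a small relative error. For `k ≥ 1` the
line through the exact saddle point shows that the terms are exponentially smaller, with sum
bounded by that of `1 / (k + 1 / 2)²`.
-/

namespace RiemannAux

open Complex MeasureTheory Filter Set Topology
open scoped Real

theorem integral_horizontal_line_eq {E : Type*} [NormedAddCommGroup E] [NormedSpace ℂ E]
    {f : ℂ → E} {a b : ℝ} (hab : a ≤ b)
    (hc : ContinuousOn f {z | z.im ∈ Icc a b}) (hd : DifferentiableOn ℂ f {z | z.im ∈ Ioo a b})
    (ha : Integrable fun u : ℝ => f (u + a * I)) (hb : Integrable fun u : ℝ => f (u + b * I))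
    {B : ℝ → ℝ} (hB0 : Tendsto B (cocompact ℝ) (𝓝 0))
    (hB : ∀ᶠ u : ℝ in cocompact ℝ, ∀ y ∈ Icc a b, ‖f (u + y * I)‖ ≤ B u) :
    ∫ u : ℝ, f (u + a * I) = ∫ u : ℝ, f (u + b * I) := by
  have hside : Tendsto (fun u : ℝ => ∫ y in a..b, f (u + y * I)) (cocompact ℝ) (𝓝 0) := by
    refine squeeze_zero_norm' (a := fun u => B u * |b - a|) ?_ (by simpa using hB0.mul_const _)
    filter_upwards [hB] with u hu
    refine intervalIntegral.norm_integral_le_of_norm_le_const fun y hy => hu y ?_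
    rw [uIoc_of_le hab] at hy
    exact Ioc_subset_Icc_self hy
  rw [cocompact_eq_atBot_atTop, tendsto_sup] at hside
  have hdiff : Tendsto (fun T : ℝ => (∫ u : ℝ in -T..T, f (u + a * I)) -
      ∫ u : ℝ in -T..T, f (u + b * I)) atTop (𝓝 0) := by
    have hlim := ((hside.1.comp tendsto_neg_atTop_atBot).sub hside.2).const_smul I
    rw [sub_zero, smul_zero] at hlim
    refine hlim.congr fun T => ?_
    have hrect := Complex.integral_boundary_rect_eq_zero_of_continuousOn_of_differentiableOn f
      (⟨-T, a⟩ : ℂ) (⟨T, b⟩ : ℂ) (hc.mono fun z hz => by simpa [uIcc_of_le hab] using hz.2)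
      (hd.mono fun z hz => by simpa [hab] using hz.2)
    rw [Function.comp_apply, smul_sub, sub_eq_iff_eq_add', ← sub_eq_zero, ← neg_eq_zero, ← hrect]
    abel
  rw [← sub_eq_zero]
  exact tendsto_nhds_unique
    ((intervalIntegral_tendsto_integral ha tendsto_neg_atTop_atBot tendsto_id).sub
      (intervalIntegral_tendsto_integral hb tendsto_neg_atTop_atBot tendsto_id)) hdiff

theorem abs_im_le_norm_sin (z : ℂ) : |z.im| ≤ ‖sin z‖ := by
  calc |z.im| ≤ Real.sinh |z.im| := Real.self_le_sinh_iff.2 (abs_nonneg _)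
    _ = |Real.exp z.im - Real.exp (-z.im)| / 2 := by
      rw [← Real.abs_sinh, Real.sinh_eq, abs_div, abs_two]
    _ = |‖exp (-z * I)‖ - ‖exp (z * I)‖| / 2 := by simp [norm_exp]
    _ ≤ ‖exp (-z * I) - exp (z * I)‖ / 2 := by gcongr; exact abs_norm_sub_norm_le _ _
    _ = ‖sin z‖ := by simp [Complex.sin]

theorem norm_cpow_le_factorial_mul_exp (x : ℂ) {w : ℂ} (hw : 0 ≤ w.re) {N : ℕ} (hN : w.re ≤ N) :
    ‖x ^ w‖ ≤ N.factorial * Real.exp (‖x‖ + 1) * Real.exp (π * |w.im|) := by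
  have hpow : ‖x‖ ^ w.re ≤ N.factorial * Real.exp (‖x‖ + 1) := by
    calc ‖x‖ ^ w.re ≤ (‖x‖ + 1) ^ w.re := by gcongr; linarith
      _ ≤ (‖x‖ + 1) ^ (N : ℝ) := by gcongr; linarith [norm_nonneg x]
      _ = (‖x‖ + 1) ^ N := Real.rpow_natCast _ _
      _ ≤ N.factorial * Real.exp (‖x‖ + 1) := by
        have := Real.pow_div_factorial_le_exp (‖x‖ + 1) (by positivity) N
        rwa [div_le_iff₀' (by positivity)] at this
  have harg : -(x.arg * w.im) ≤ π * |w.im| :=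
    calc -(x.arg * w.im) ≤ |x.arg * w.im| := neg_le_abs _
      _ = |x.arg| * |w.im| := abs_mul _ _
      _ ≤ π * |w.im| := by gcongr; exact abs_arg_le_pi x
  calc ‖x ^ w‖ ≤ ‖x‖ ^ w.re * Real.exp (-(x.arg * w.im)) := by
        rw [Real.exp_neg, ← div_eq_mul_inv]; exact norm_cpow_le x w
    _ ≤ _ := by gcongr

theorem ofReal_mul_cpow {r : ℝ} (hr : 0 < r) {x : ℂ} (hx : x ≠ 0) (w : ℂ) :
    ((r : ℂ) * x) ^ w = (r : ℂ) ^ w * x ^ w := by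
  have hr' : (r : ℂ) ≠ 0 := ofReal_ne_zero.2 hr.ne'
  rw [cpow_def_of_ne_zero (mul_ne_zero hr' hx), log_ofReal_mul hr hx,
    cpow_def_of_ne_zero hr', cpow_def_of_ne_zero hx, ← exp_add, ofReal_log hr.le, add_mul]

theorem exp_cpow {z : ℂ} (hz : z.im ∈ Ioc (-π) π) (w : ℂ) : exp z ^ w = exp (z * w) := by
  rw [cpow_def_of_ne_zero (exp_ne_zero _), log_exp hz.1 hz.2]

/-- The eighth root of unity `e^{π i / 4}`, the direction of the path of integration. -/
noncomputable def zeta8 : ℂ := exp (π * I / 4)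

theorem zeta8_eq_exp : zeta8 = exp ((π / 4 : ℝ) * I) := by
  rw [zeta8]; congr 1; push_cast; ring

theorem zeta8_re : zeta8.re = √2 / 2 := by
  rw [zeta8_eq_exp, exp_ofReal_mul_I_re, Real.cos_pi_div_four]

theorem zeta8_im : zeta8.im = √2 / 2 := by
  rw [zeta8_eq_exp, exp_ofReal_mul_I_im, Real.sin_pi_div_four]

theorem zeta8_sq : zeta8 ^ 2 = I := by
  rw [zeta8, ← Complex.exp_nat_mul,
    show ((2 : ℕ) : ℂ) * (π * I / 4) = π / 2 * I by push_cast; ring, exp_pi_div_two_mul_I]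

theorem zeta8_ne_zero : zeta8 ≠ 0 := exp_ne_zero _

theorem norm_zeta8 : ‖zeta8‖ = 1 := by
  rw [zeta8_eq_exp, norm_exp_ofReal_mul_I]

theorem zeta8_mul_re (z : ℂ) : (zeta8 * z).re = √2 / 2 * (z.re - z.im) := by
  rw [mul_re, zeta8_re, zeta8_im, mul_sub]

theorem zeta8_mul_im (z : ℂ) : (zeta8 * z).im = √2 / 2 * (z.re + z.im) := by
  rw [mul_im, zeta8_re, zeta8_im]; ring

theorem integrand_eq (s x : ℂ) :
    integrand s x = x ^ (-s) * exp (π * I * x ^ 2) / (2 * I * sin (π * x)) := by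
  have hsin : exp (π * I * x) - exp (-(π * I * x)) = 2 * I * sin (π * x) := by
    rw [mul_right_comm (π : ℂ) I x, Complex.sin, neg_mul]
    linear_combination (exp (π * x * I) - exp (-(π * x * I))) * I_sq
  rw [integrand, hsin]

theorem path_eq (u : ℝ) :
    path u = zeta8 * ((u + √2 / 4 : ℝ) + (-(√2 / 4) : ℝ) * I) := by
  have hsqrt : √2 * √2 = 2 := Real.mul_self_sqrt zero_le_two
  have hpath : path u = 1 / 2 + u * zeta8 := rfl
  apply Complex.ext
  · rw [zeta8_mul_re, hpath]
    simp [zeta8_re]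
    linear_combination (-1 / 4) * hsqrt
  · rw [zeta8_mul_im, hpath]
    simp [zeta8_im]
    ring

theorem zeta8_mul_re_mem_Ioo {z : ℂ} (hz : z.im ∈ Ico (-(√2 / 4)) 0) (h : (zeta8 * z).im = 0) :
    (zeta8 * z).re ∈ Ioo 0 1 := by
  have hsqrt : √2 * √2 = 2 := Real.mul_self_sqrt zero_le_two
  have hpos : 0 < √2 := by positivity
  have hre : z.re = -z.im := by
    rw [zeta8_mul_im] at h
    linarith [(mul_eq_zero.1 h).resolve_left (by positivity)]
  rw [zeta8_mul_re, hre]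
  constructor <;> nlinarith [hz.1, hz.2]

theorem zeta8_mul_mem_slitPlane {z : ℂ} (hz : z.im ∈ Icc (-(√2 / 4)) 0) (hz0 : z ≠ 0) :
    zeta8 * z ∈ slitPlane := by
  rw [mem_slitPlane_iff, or_iff_not_imp_right, not_ne_iff]
  intro him
  refine (zeta8_mul_re_mem_Ioo ⟨hz.1, lt_of_le_of_ne hz.2 fun h => hz0 ?_⟩ him).1
  rw [zeta8_mul_im, h, add_zero] at him
  exact Complex.ext ((mul_eq_zero.1 him).resolve_left (by positivity)) h

theorem sin_pi_mul_zeta8_mul_ne_zero {z : ℂ} (hz : z.im ∈ Icc (-(√2 / 4)) 0) (hz0 : z ≠ 0) :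
    sin (π * (zeta8 * z)) ≠ 0 := by
  intro hsin
  obtain ⟨k, hk⟩ := sin_eq_zero_iff.1 hsin
  have hzk : zeta8 * z = k :=
    mul_left_cancel₀ (ofReal_ne_zero.2 Real.pi_ne_zero) (hk.trans (mul_comm _ _))
  have him : z.im ≠ 0 := by
    intro h
    have : (zeta8 * z).im = 0 := by rw [hzk, intCast_im]
    rw [zeta8_mul_im, h, add_zero] at this
    exact hz0 (Complex.ext ((mul_eq_zero.1 this).resolve_left (by positivity)) h)
  have hmem := zeta8_mul_re_mem_Ioo ⟨hz.1, lt_of_le_of_ne hz.2 him⟩ (by rw [hzk, intCast_im])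
  rw [hzk, intCast_re] at hmem
  have hk0 : 0 < k := by exact_mod_cast hmem.1
  have hk1 : k < 1 := by exact_mod_cast hmem.2
  omega

theorem differentiableAt_integrand (s : ℂ) {x : ℂ} (hx : x ∈ slitPlane) (hsin : sin (π * x) ≠ 0) :
    DifferentiableAt ℂ (integrand s) x := by
  rw [funext (integrand_eq s)]
  refine ((hasStrictDerivAt_cpow_const hx).hasDerivAt.differentiableAt.mul (by fun_prop)).div
    (by fun_prop) (mul_ne_zero (by simp) hsin)

theorem continuousAt_integrand_zero {s : ℂ} (hs : s.re < -1) : ContinuousAt (integrand s) 0 := by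
  have hs1 : 0 < (-s - 1).re := by simp; linarith
  have hsin : HasDerivAt (fun x : ℂ => sin (π * x)) π 0 := by
    simpa using ((hasDerivAt_id (0 : ℂ)).const_mul (π : ℂ)).csin
  -- One factor `x` of `x ^ (-s)` is absorbed by the simple zero of the sine.
  have heq : integrand s = fun x => x ^ (-s - 1) * exp (π * I * x ^ 2) /
      (2 * I * dslope (fun x : ℂ => sin (π * x)) 0 x) := by
    ext x
    rw [integrand_eq]
    rcases eq_or_ne x 0 with rfl | hx
    · have hne : -s - 1 ≠ 0 := fun h => by simp [h] at hs1
      simp [zero_cpow hne]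
    · rw [dslope_of_ne _ hx, slope_def_field, mul_zero, sin_zero, sub_zero, sub_zero,
        cpow_sub _ _ hx, cpow_one]
      field_simp
  rw [heq]
  refine ((continuousAt_cpow_const_of_re_pos (Or.inl le_rfl) hs1).mul (by fun_prop)).div
    (continuousAt_const.mul (continuousAt_dslope_same.2 hsin.differentiableAt)) ?_
  rw [dslope_same, hsin.deriv]
  simp [Real.pi_ne_zero]

theorem norm_exp_pi_mul_I_mul_zeta8_mul_sq (z : ℂ) :
    ‖exp (π * I * (zeta8 * z) ^ 2)‖ = Real.exp (-(π * (z.re ^ 2 - z.im ^ 2))) := by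
  rw [norm_exp, mul_pow, zeta8_sq]
  congr 1
  simp [sq]

theorem one_le_norm_two_mul_I_mul_sin {z : ℂ} (hre : 1 ≤ |z.re|) (him : |z.im| ≤ √2 / 4) :
    1 ≤ ‖2 * I * sin (π * (zeta8 * z))‖ := by
  have hsqrt : √2 ≤ 3 / 2 := by rw [Real.sqrt_le_left] <;> norm_num
  have hsqrt' : 1 ≤ √2 := Real.one_le_sqrt.2 one_le_two
  have hsum : 5 / 8 ≤ |z.re + z.im| := by
    have := abs_sub_abs_le_abs_add z.re z.im
    linarith
  calc (1 : ℝ) ≤ 2 * (3 * (1 / 2 * (5 / 8))) := by norm_num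
    _ ≤ 2 * (π * (√2 / 2 * |z.re + z.im|)) := by gcongr; exact Real.pi_gt_three.le
    _ = 2 * |(π * (zeta8 * z)).im| := by
      rw [im_ofReal_mul, zeta8_mul_im, abs_mul, abs_mul, abs_of_pos Real.pi_pos,
        abs_of_pos (show 0 < √2 / 2 by positivity)]
    _ ≤ 2 * ‖sin (π * (zeta8 * z))‖ := by gcongr; exact abs_im_le_norm_sin _
    _ = ‖2 * I * sin (π * (zeta8 * z))‖ := by simp

theorem exists_norm_integrand_zeta8_mul_le {s : ℂ} (hs : s.re ≤ 0) :
    ∃ C : ℝ, ∀ z : ℂ, 1 ≤ |z.re| → |z.im| ≤ √2 / 4 →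
      ‖integrand s (zeta8 * z)‖ ≤ C * Real.exp (-1 * z.re ^ 2) := by
  obtain ⟨N, hN⟩ := exists_nat_ge (-s.re)
  refine ⟨N.factorial * Real.exp (π * |(-s).im|) * Real.exp 7, fun z hre him => ?_⟩
  have him' : |z.im| ≤ 1 / 2 := by
    have hsqrt : √2 ≤ 2 := by rw [Real.sqrt_le_left] <;> norm_num
    linarith
  have hcpow : ‖(zeta8 * z) ^ (-s)‖ ≤
      N.factorial * Real.exp (|z.re| + 2) * Real.exp (π * |(-s).im|) := by
    refine (norm_cpow_le_factorial_mul_exp _ (by simpa using hs) hN).trans ?_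
    rw [norm_mul, norm_zeta8, one_mul]
    gcongr ?_ * Real.exp ?_ * ?_
    linarith [norm_le_abs_re_add_abs_im z]
  have hgauss : ‖exp (π * I * (zeta8 * z) ^ 2)‖ ≤ Real.exp (-(3 * z.re ^ 2) + 1) := by
    rw [norm_exp_pi_mul_I_mul_zeta8_mul_sq, Real.exp_le_exp]
    have him_sq : z.im ^ 2 ≤ 1 / 4 := by rw [← sq_abs]; nlinarith [abs_nonneg z.im]
    nlinarith [sq_nonneg z.re, sq_nonneg z.im, Real.pi_gt_three, Real.pi_le_four]
  rw [integrand_eq, norm_div]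
  calc _ ≤ ‖(zeta8 * z) ^ (-s) * exp (π * I * (zeta8 * z) ^ 2)‖ :=
        div_le_self (norm_nonneg _) (one_le_norm_two_mul_I_mul_sin hre him)
    _ ≤ N.factorial * Real.exp (|z.re| + 2) * Real.exp (π * |(-s).im|) *
        Real.exp (-(3 * z.re ^ 2) + 1) := by rw [norm_mul]; gcongr
    _ = N.factorial * Real.exp (π * |(-s).im|) *
        Real.exp (|z.re| + 2 + (-(3 * z.re ^ 2) + 1)) := by rw [Real.exp_add (|z.re| + 2)]; ring
    _ ≤ N.factorial * Real.exp (π * |(-s).im|) * Real.exp (7 + -1 * z.re ^ 2) := by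
        gcongr _ * Real.exp ?_
        nlinarith [sq_abs z.re, sq_nonneg (|z.re| - 1)]
    _ = _ := by rw [Real.exp_add 7]; ring

theorem continuousOn_integrand_zeta8_mul {s : ℂ} (hs : s.re < -1) :
    ContinuousOn (fun z => integrand s (zeta8 * z)) {z | z.im ∈ Icc (-(√2 / 4)) 0} := by
  intro z hz
  suffices ContinuousAt (integrand s) (zeta8 * z) from
    (ContinuousAt.comp (f := fun z => zeta8 * z) this (by fun_prop)).continuousWithinAt
  rcases eq_or_ne z 0 with rfl | hz0
  · simpa using continuousAt_integrand_zero hs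
  · exact (differentiableAt_integrand s (zeta8_mul_mem_slitPlane hz hz0)
      (sin_pi_mul_zeta8_mul_ne_zero hz hz0)).continuousAt

theorem differentiableOn_integrand_zeta8_mul (s : ℂ) :
    DifferentiableOn ℂ (fun z => integrand s (zeta8 * z)) {z | z.im ∈ Ioo (-(√2 / 4)) 0} := by
  intro z hz
  have hz0 : z ≠ 0 := fun h => by simp [h] at hz
  have hz' := Ioo_subset_Icc_self hz
  exact (DifferentiableAt.comp (f := fun z => zeta8 * z) z
    (differentiableAt_integrand s (zeta8_mul_mem_slitPlane hz' hz0)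
      (sin_pi_mul_zeta8_mul_ne_zero hz' hz0)) (by fun_prop)).differentiableWithinAt

theorem integrable_integrand_zeta8_mul {s : ℂ} (hs : s.re < -1) {y : ℝ}
    (hy : y ∈ Icc (-(√2 / 4)) 0) : Integrable fun u : ℝ => integrand s (zeta8 * (u + y * I)) := by
  obtain ⟨C, hC⟩ := exists_norm_integrand_zeta8_mul_le (s := s) (by linarith)
  have hcont : Continuous fun u : ℝ => integrand s (zeta8 * (u + y * I)) :=
    (continuousOn_integrand_zeta8_mul hs).comp_continuous (by fun_prop) fun u => by simpa using hy
  refine hcont.locallyIntegrable.integrable_of_isBigO_cocompact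
    (g := fun u => Real.exp (-1 * u ^ 2)) (.of_bound C ?_)
    ((integrable_exp_neg_mul_sq one_pos).integrableAtFilter _)
  filter_upwards [(tendsto_norm_cocompact_atTop (E := ℝ)).eventually_ge_atTop 1] with u hu
  have hu' := hC (u + y * I) (by simpa using hu) (by
    simpa [abs_of_nonpos hy.2] using neg_le.1 hy.1)
  simpa [Real.norm_of_nonneg, Real.exp_nonneg] using hu'

theorem R_eq_neg_zeta8_mul_integral {s : ℂ} (hs : s.re < -1) :
    R s = -(zeta8 * ∫ u : ℝ, integrand s (zeta8 * u)) := by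
  obtain ⟨C, hC⟩ := exists_norm_integrand_zeta8_mul_le (s := s) (by linarith)
  have hsqrt : -(√2 / 4) ≤ 0 := by rw [Left.neg_nonpos_iff]; positivity
  have hdecay : Tendsto (fun u : ℝ => C * Real.exp (-1 * u ^ 2)) (cocompact ℝ) (𝓝 0) := by
    have hsq : Tendsto (fun u : ℝ => u ^ 2) (cocompact ℝ) atTop := by
      simpa only [Function.comp_def, Real.norm_eq_abs, sq_abs] using
        (tendsto_pow_atTop two_ne_zero).comp (tendsto_norm_cocompact_atTop (E := ℝ))
    simpa [Function.comp_def] using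
      (Real.tendsto_exp_atBot.comp (tendsto_neg_atTop_atBot.comp hsq)).const_mul C
  have hshift := integral_horizontal_line_eq (f := fun z => integrand s (zeta8 * z)) hsqrt
    (continuousOn_integrand_zeta8_mul hs) (differentiableOn_integrand_zeta8_mul s)
    (integrable_integrand_zeta8_mul hs (left_mem_Icc.2 hsqrt))
    (integrable_integrand_zeta8_mul hs (right_mem_Icc.2 hsqrt)) hdecay (by
      filter_upwards [(tendsto_norm_cocompact_atTop (E := ℝ)).eventually_ge_atTop 1] with u hu y hy
      simpa using hC (u + y * I) (by simpa using hu)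
        (by simpa [abs_of_nonpos hy.2] using neg_le.1 hy.1))
  simp only [ofReal_zero, zero_mul, add_zero] at hshift
  rw [R, ← zeta8, integral_mul_const, ← hshift, mul_comm zeta8]
  simp_rw [path_eq]
  rw [integral_add_right_eq_self
    (fun v : ℝ => integrand s (zeta8 * (v + (-(√2 / 4) : ℝ) * I)))]

theorem zeta8_cpow (w : ℂ) : zeta8 ^ w = exp (π * I / 4 * w) := by
  have him : (π * I / 4).im = π / 4 := by simp
  rw [zeta8, exp_cpow]
  rw [him]
  constructor <;> linarith [Real.pi_pos]

theorem neg_zeta8_cpow (w : ℂ) : (-zeta8) ^ w = exp (-(3 * π * I / 4) * w) := by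
  have hneg : -zeta8 = exp (-(3 * π * I / 4)) := by
    rw [show -(3 * π * I / 4) = π * I / 4 - π * I by ring, exp_sub, exp_pi_mul_I, zeta8, div_neg,
      div_one]
  have him : (-(3 * π * I / 4)).im = -(3 * π / 4) := by simp
  rw [hneg, exp_cpow]
  rw [him]
  constructor <;> linarith [Real.pi_pos]

/-- The kernel `e^{π i x²} / sin (π x)` on the line `x = e^{π i / 4} v`. Its Mellin transform is
Riemann's function up to elementary factors. -/
noncomputable def rayKernel (v : ℝ) : ℂ := exp (-(π * v ^ 2)) / sin (π * (zeta8 * v))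

theorem rayKernel_neg (v : ℝ) : rayKernel (-v) = -rayKernel v := by
  simp [rayKernel, div_neg]

theorem le_norm_sin_pi_mul_zeta8_mul {v : ℝ} (hv : 0 ≤ v) : v ≤ ‖sin (π * (zeta8 * v))‖ := by
  have hsqrt : 1 ≤ √2 := Real.one_le_sqrt.2 one_le_two
  calc v ≤ 3 * (1 / 2 * v) := by linarith
    _ ≤ π * (√2 / 2 * v) := by gcongr; exact Real.pi_gt_three.le
    _ = (π * (zeta8 * v)).im := by rw [im_ofReal_mul, zeta8_mul_im, ofReal_re, ofReal_im, add_zero]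
    _ ≤ ‖sin (π * (zeta8 * v))‖ := (le_abs_self _).trans (abs_im_le_norm_sin _)

theorem norm_rayKernel_le {v : ℝ} (hv : 0 < v) : ‖rayKernel v‖ ≤ Real.exp (-(π * v ^ 2)) / v := by
  have hre : (-(π * v ^ 2) : ℂ).re = -(π * v ^ 2) := by
    rw [← ofReal_pow, ← ofReal_mul, ← ofReal_neg, ofReal_re]
  rw [rayKernel, norm_div, norm_exp, hre]
  gcongr
  exact le_norm_sin_pi_mul_zeta8_mul hv.le

theorem continuousOn_rayKernel : ContinuousOn rayKernel (Ioi 0) := by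
  unfold rayKernel
  exact ContinuousOn.div (by fun_prop) (by fun_prop) fun v hv =>
    norm_pos_iff.1 (hv.out.trans_le (le_norm_sin_pi_mul_zeta8_mul hv.out.le))

theorem differentiableAt_mellin_rayKernel {w : ℂ} (hw : 1 < w.re) :
    DifferentiableAt ℂ (mellin rayKernel) w := by
  refine mellin_differentiableAt_of_isBigO_rpow_exp one_pos
    (continuousOn_rayKernel.locallyIntegrableOn measurableSet_Ioi) (.of_bound 1 ?_)
    (.of_bound 1 ?_) hw
  · filter_upwards [eventually_ge_atTop (1 : ℝ)] with v hv
    rw [one_mul, Real.norm_of_nonneg (Real.exp_nonneg _)]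
    refine (norm_rayKernel_le (by linarith)).trans
      ((div_le_self (Real.exp_nonneg _) hv).trans (Real.exp_le_exp.2 ?_))
    nlinarith [Real.pi_gt_three]
  · filter_upwards [self_mem_nhdsWithin] with v hv
    rw [one_mul, Real.rpow_neg_one, norm_inv, Real.norm_of_nonneg hv.out.le, inv_eq_one_div]
    refine (norm_rayKernel_le hv).trans ?_
    gcongr
    · exact hv.out.le
    · rw [Real.exp_le_one_iff, Left.neg_nonpos_iff]
      positivity

theorem integrand_zeta8_mul (s : ℂ) (v : ℝ) :
    integrand s (zeta8 * v) = (zeta8 * v) ^ (-s) * rayKernel v / (2 * I) := by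
  have hexp : π * I * (zeta8 * v) ^ 2 = -(π * v ^ 2) := by
    rw [mul_pow, zeta8_sq]
    linear_combination (π * v ^ 2 : ℂ) * I_sq
  rw [integrand_eq, hexp, rayKernel, mul_comm (2 * I), mul_div_assoc', div_div]

theorem zeta8_cpow_neg_sub_neg_zeta8_cpow_neg (s : ℂ) :
    zeta8 ^ (-s) - (-zeta8) ^ (-s) = -(2 * I * exp (π * I * s / 4) * sin (π * s / 2)) := by
  have hpos : zeta8 ^ (-s) = exp (π * I * s / 4) * exp (-(π * s / 2) * I) := by
    rw [zeta8_cpow, ← exp_add]; ring_nf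
  have hneg : (-zeta8) ^ (-s) = exp (π * I * s / 4) * exp (π * s / 2 * I) := by
    rw [neg_zeta8_cpow, ← exp_add]; ring_nf
  rw [hpos, hneg, Complex.sin]
  linear_combination
    exp (π * I * s / 4) * (exp (-(π * s / 2) * I) - exp (π * s / 2 * I)) * I_sq

theorem R_eq_mellin {s : ℂ} (hs : s.re < -1) :
    R s = zeta8 * exp (π * I * s / 4) * sin (π * s / 2) * mellin rayKernel (1 - s) := by
  have hint : Integrable fun u : ℝ => integrand s (zeta8 * u) := by
    simpa using integrable_integrand_zeta8_mul hs (y := 0)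
      ⟨by rw [Left.neg_nonpos_iff]; positivity, le_rfl⟩
  have hpos : ∫ v in Ioi (0 : ℝ), integrand s (zeta8 * v) =
      zeta8 ^ (-s) / (2 * I) * mellin rayKernel (1 - s) := by
    rw [mellin, ← integral_const_mul]
    refine setIntegral_congr_fun measurableSet_Ioi fun v hv => ?_
    rw [integrand_zeta8_mul, mul_comm zeta8, ofReal_mul_cpow hv zeta8_ne_zero, smul_eq_mul,
      show 1 - s - 1 = -s by ring]
    ring
  have hneg : ∫ v in Iic (0 : ℝ), integrand s (zeta8 * v) =
      -((-zeta8) ^ (-s)) / (2 * I) * mellin rayKernel (1 - s) := by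
    have hreflect := integral_comp_neg_Ioi 0 (fun v : ℝ => integrand s (zeta8 * v))
    rw [neg_zero] at hreflect
    rw [← hreflect, mellin, ← integral_const_mul]
    refine setIntegral_congr_fun measurableSet_Ioi fun v hv => ?_
    rw [integrand_zeta8_mul, rayKernel_neg, ofReal_neg, mul_neg zeta8, mul_comm zeta8,
      ← mul_neg (v : ℂ), ofReal_mul_cpow hv (neg_ne_zero.2 zeta8_ne_zero), smul_eq_mul,
      show 1 - s - 1 = -s by ring]
    ring
  rw [R_eq_neg_zeta8_mul_integral hs,
    ← intervalIntegral.integral_Iic_add_Ioi (b := 0) hint.integrableOn hint.integrableOn,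
    hneg, hpos, ← add_mul, ← add_div, neg_add_eq_sub, zeta8_cpow_neg_sub_neg_zeta8_cpow_neg]
  field_simp

theorem norm_cpow_mul_exp_neg_mul (a w : ℂ) {t : ℝ} (ht : 0 < t) :
    ‖(t : ℂ) ^ a * exp (-(w * t))‖ = t ^ a.re * Real.exp (-(w.re * t)) := by
  rw [norm_mul, norm_cpow_eq_rpow_re_of_pos ht, norm_exp, neg_re, re_mul_ofReal]

theorem integrableOn_rpow_mul_exp_neg_mul {r b : ℝ} (hr : -1 < r) (hb : 0 < b) :
    IntegrableOn (fun t : ℝ => t ^ r * Real.exp (-(b * t))) (Ioi 0) := by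
  simpa using integrableOn_rpow_mul_exp_neg_mul_rpow (p := 1) hr one_pos hb

theorem aestronglyMeasurable_cpow_mul_exp_neg_mul (a w : ℂ) :
    AEStronglyMeasurable (fun t : ℝ => (t : ℂ) ^ a * exp (-(w * t)))
      (volume.restrict (Ioi 0)) := by
  refine ContinuousOn.aestronglyMeasurable (ContinuousOn.mul (fun t ht => ?_) (by fun_prop))
    measurableSet_Ioi
  exact (continuousAt_ofReal_cpow_const t a (Or.inr (ne_of_gt ht))).continuousWithinAt

theorem integrableOn_cpow_mul_exp_neg_mul {a w : ℂ} (ha : -1 < a.re) (hw : 0 < w.re) :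
    IntegrableOn (fun t : ℝ => (t : ℂ) ^ a * exp (-(w * t))) (Ioi 0) := by
  refine (integrableOn_rpow_mul_exp_neg_mul ha hw).mono'
    (aestronglyMeasurable_cpow_mul_exp_neg_mul a w) ?_
  filter_upwards [ae_restrict_mem measurableSet_Ioi] with t ht
  rw [norm_cpow_mul_exp_neg_mul a w ht]

theorem differentiableAt_integral_cpow_mul_exp_neg_mul {a w : ℂ} (ha : -1 < a.re)
    (hw : 0 < w.re) :
    DifferentiableAt ℂ (fun w : ℂ => ∫ t in Ioi (0 : ℝ), (t : ℂ) ^ a * exp (-(w * t))) w := by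
  have hhalf : 0 < w.re / 2 := half_pos hw
  refine (hasDerivAt_integral_of_dominated_loc_of_deriv_le
    (F' := fun z t => (t : ℂ) ^ a * exp (-(z * t)) * -t)
    (bound := fun t => t ^ (a.re + 1) * Real.exp (-(w.re / 2 * t)))
    (Metric.ball_mem_nhds w hhalf)
    (Eventually.of_forall fun z => aestronglyMeasurable_cpow_mul_exp_neg_mul a z)
    (integrableOn_cpow_mul_exp_neg_mul ha hw)
    ((aestronglyMeasurable_cpow_mul_exp_neg_mul a w).mul
      (Continuous.aestronglyMeasurable (by fun_prop)))
    ?_ (integrableOn_rpow_mul_exp_neg_mul (by linarith) hhalf) ?_).2.differentiableAt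
  · filter_upwards [ae_restrict_mem measurableSet_Ioi] with t ht z hz
    have ht : 0 < t := ht
    have hre : w.re / 2 ≤ z.re := by
      have := (abs_re_le_norm (z - w)).trans (mem_ball_iff_norm.1 hz).le
      rw [sub_re, abs_le] at this
      linarith [this.1]
    rw [norm_mul, norm_cpow_mul_exp_neg_mul a z ht, norm_neg, norm_real,
      Real.norm_of_nonneg ht.le, mul_right_comm, ← Real.rpow_add_one ht.ne']
    gcongr
  · refine Eventually.of_forall fun t z _ => ?_
    rw [mul_assoc]
    refine HasDerivAt.const_mul _ (HasDerivAt.cexp ?_)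
    simpa using (hasDerivAt_mul_const (x := z) (t : ℂ)).fun_neg

theorem integral_cpow_mul_exp_neg_mul_of_re_pos {a w : ℂ} (ha : 0 < a.re) (hw : 0 < w.re) :
    ∫ t in Ioi (0 : ℝ), (t : ℂ) ^ (a - 1) * exp (-(w * t)) = w ^ (-a) * Gamma a := by
  have hopen : IsOpen {z : ℂ | 0 < z.re} := isOpen_lt continuous_const continuous_re
  have hleft : AnalyticOnNhd ℂ
      (fun w : ℂ => ∫ t in Ioi (0 : ℝ), (t : ℂ) ^ (a - 1) * exp (-(w * t))) {z | 0 < z.re} :=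
    DifferentiableOn.analyticOnNhd (fun z hz =>
      (differentiableAt_integral_cpow_mul_exp_neg_mul (by simpa)
        hz).differentiableWithinAt) hopen
  have hright : AnalyticOnNhd ℂ (fun w : ℂ => w ^ (-a) * Gamma a) {z | 0 < z.re} :=
    DifferentiableOn.analyticOnNhd (fun z hz =>
      ((hasStrictDerivAt_cpow_const (Or.inl hz)).hasDerivAt.differentiableAt.mul_const
        _).differentiableWithinAt) hopen
  refine hleft.eqOn_of_preconnected_of_frequently_eq hright
    (convex_halfSpace_re_gt 0).isPreconnected (z₀ := ((1 : ℝ) : ℂ)) (by simp) ?_ hw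
  have hreal : Tendsto ((↑) : ℝ → ℂ) (𝓝[≠] 1) (𝓝[≠] (1 : ℝ)) :=
    continuous_ofReal.continuousWithinAt.tendsto_nhdsWithin fun r hr => by simpa using hr
  refine hreal.frequently (Eventually.frequently ?_)
  filter_upwards [nhdsWithin_le_nhds (Ioi_mem_nhds one_pos)] with r hr
  rw [integral_cpow_mul_exp_neg_mul_Ioi ha hr, one_div, cpow_neg, inv_cpow]
  rw [arg_ofReal_of_nonneg hr.out.le]
  exact Real.pi_pos.ne

/-- The integral of `w^{-l} e^{π w² - 2 π κ w}` along the vertical line `w = D + i u`, with respect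
to `u`; it does not depend on `D > 0`. -/
noncomputable def verticalIntegral (l κ : ℂ) (D : ℝ) : ℂ :=
  ∫ u : ℝ, (D + u * I : ℂ) ^ (-l) * exp (π * (D + u * I) ^ 2 - 2 * π * κ * (D + u * I))

theorem gaussian_exponent_on_line (κ : ℂ) (D u : ℝ) :
    π * (D + u * I) ^ 2 - 2 * π * κ * (D + u * I) =
      -π * u ^ 2 + 2 * π * (D - κ) * I * u + (π * D ^ 2 - 2 * π * κ * D) := by
  linear_combination (π * u ^ 2 : ℂ) * I_sq

theorem integrable_gaussian_on_line (κ : ℂ) (D : ℝ) :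
    Integrable fun u : ℝ => exp (π * (D + u * I) ^ 2 - 2 * π * κ * (D + u * I)) := by
  simp_rw [gaussian_exponent_on_line κ D]
  exact integrable_cexp_quadratic' (by simp [Real.pi_pos]) _ _

theorem integral_gaussian_on_line (κ : ℂ) (D : ℝ) :
    ∫ u : ℝ, exp (π * (D + u * I) ^ 2 - 2 * π * κ * (D + u * I)) = exp (-(π * κ ^ 2)) := by
  have hpi : (π : ℂ) ≠ 0 := ofReal_ne_zero.2 Real.pi_ne_zero
  simp_rw [gaussian_exponent_on_line κ D]
  rw [integral_cexp_quadratic (by simp [Real.pi_pos]), neg_neg, div_self hpi, one_cpow, one_mul]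
  congr 1
  field_simp
  linear_combination (4 * (D - κ) ^ 2 : ℂ) * I_sq

theorem integrable_gaussian_on_line_mul_cpow_mul_exp {l : ℂ} (hl : 0 < l.re) (κ : ℂ) {D : ℝ}
    (hD : 0 < D) :
    Integrable (Function.uncurry fun u v : ℝ =>
      exp (π * (D + u * I) ^ 2 - 2 * π * κ * (D + u * I)) *
        ((v : ℂ) ^ (l - 1) * exp (-((2 * π : ℝ) * (D + u * I) * v))))
      (volume.prod (volume.restrict (Ioi 0))) := by
  have hprod := (integrable_gaussian_on_line κ D).mul_prod
    (integrableOn_cpow_mul_exp_neg_mul (a := l - 1) (w := (2 * π * D : ℝ)) (by simpa)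
      (by rw [ofReal_re]; positivity))
  refine (hprod.bdd_mul (c := 1) (f := fun z : ℝ × ℝ => exp ((-(2 * π * z.1 * z.2) : ℝ) * I))
    (Continuous.aestronglyMeasurable (by fun_prop))
    (Eventually.of_forall fun z => (norm_exp_ofReal_mul_I _).le)).congr
    (Eventually.of_forall fun z => ?_)
  have hsplit : exp (-((2 * π : ℝ) * (D + z.1 * I) * z.2)) =
      exp ((-(2 * π * z.1 * z.2) : ℝ) * I) * exp (-((2 * π * D : ℝ) * z.2)) := by
    rw [← exp_add]; push_cast; ring_nf
  simp only [Function.uncurry, hsplit]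
  ring

/-- Since `w^{-l}` is a Laplace transform, both sides are iterated integrals of the same function
of `(u, v)`. -/
theorem integral_cpow_mul_gaussian {l : ℂ} (hl : 0 < l.re) (κ : ℂ) {D : ℝ} (hD : 0 < D) :
    ∫ v in Ioi (0 : ℝ), (v : ℂ) ^ (l - 1) * exp (-(π * v ^ 2) - 2 * π * κ * v) =
      exp (π * κ ^ 2) * (2 * π : ℝ) ^ (-l) * Gamma l * verticalIntegral l κ D := by
  have hinner_v (u : ℝ) : ∫ v in Ioi (0 : ℝ),
      exp (π * (D + u * I) ^ 2 - 2 * π * κ * (D + u * I)) *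
        ((v : ℂ) ^ (l - 1) * exp (-((2 * π : ℝ) * (D + u * I) * v))) =
      (2 * π : ℝ) ^ (-l) * Gamma l *
        ((D + u * I) ^ (-l) * exp (π * (D + u * I) ^ 2 - 2 * π * κ * (D + u * I))) := by
    have hne : (D + u * I : ℂ) ≠ 0 := fun h => hD.ne' (by simpa using congrArg re h)
    have hre : 0 < ((2 * π : ℝ) * (D + u * I)).re := by
      rw [re_ofReal_mul]
      simpa using mul_pos Real.two_pi_pos hD
    rw [integral_const_mul, integral_cpow_mul_exp_neg_mul_of_re_pos hl hre,
      ofReal_mul_cpow (by positivity) hne]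
    ring
  have hinner_u (v : ℝ) : ∫ u : ℝ, exp (π * (D + u * I) ^ 2 - 2 * π * κ * (D + u * I)) *
        ((v : ℂ) ^ (l - 1) * exp (-((2 * π : ℝ) * (D + u * I) * v))) =
      exp (-(π * κ ^ 2)) * ((v : ℂ) ^ (l - 1) * exp (-(π * v ^ 2) - 2 * π * κ * v)) := by
    have hshift (u : ℝ) : exp (π * (D + u * I) ^ 2 - 2 * π * κ * (D + u * I)) *
        ((v : ℂ) ^ (l - 1) * exp (-((2 * π : ℝ) * (D + u * I) * v))) =
        (v : ℂ) ^ (l - 1) *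
          exp (π * (D + u * I) ^ 2 - 2 * π * (κ + v) * (D + u * I)) := by
      rw [mul_left_comm, ← exp_add]
      push_cast
      ring_nf
    simp_rw [hshift]
    rw [integral_const_mul, integral_gaussian_on_line, mul_left_comm, ← exp_add]
    ring_nf
  have hswap := integral_integral_swap (integrable_gaussian_on_line_mul_cpow_mul_exp hl κ hD)
  simp_rw [hinner_v, hinner_u, integral_const_mul] at hswap
  rw [← verticalIntegral, exp_neg, eq_inv_mul_iff_mul_eq₀ (exp_ne_zero _)] at hswap
  rw [← hswap]
  ring

/-- The `k`-th frequency `(k + 1/2) e^{-π i / 4}` in the expansion of `1 / sin (π x)` in powers of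
`e^{2 π i x}` along the ray `x = e^{π i / 4} v`. -/
noncomputable def freq (k : ℕ) : ℂ := (k + 1 / 2 : ℝ) / zeta8

theorem inv_zeta8 : zeta8⁻¹ = -(I * zeta8) := by
  refine inv_eq_of_mul_eq_one_right ?_
  linear_combination -I * zeta8_sq - I_sq

theorem freq_eq (k : ℕ) : freq k = -((k + 1 / 2 : ℝ) * (I * zeta8)) := by
  rw [freq, div_eq_mul_inv, inv_zeta8, mul_neg]

theorem freq_re (k : ℕ) : (freq k).re = √2 / 2 * (k + 1 / 2) := by
  rw [freq_eq, neg_re, re_ofReal_mul, I_mul_re, zeta8_im]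
  ring

theorem freq_im (k : ℕ) : (freq k).im = -(√2 / 2 * (k + 1 / 2)) := by
  rw [freq_eq, neg_im, im_ofReal_mul, I_mul_im, zeta8_re]
  ring

theorem freq_sq (k : ℕ) : freq k ^ 2 = -(I * (k + 1 / 2) ^ 2) := by
  rw [freq, div_pow, zeta8_sq, div_I]
  push_cast
  ring

theorem exp_pi_mul_freq_sq (k : ℕ) : exp (π * freq k ^ 2) = zeta8⁻¹ := by
  obtain ⟨m, hm⟩ := (Nat.even_mul_succ_self k).two_dvd
  have hexp : π * freq k ^ 2 = -(m * (2 * π * I)) - π * I / 4 := by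
    have hm' : (k : ℂ) * (k + 1) = 2 * m := mod_cast hm
    rw [freq_sq]
    linear_combination -(π * I) * hm'
  rw [hexp, exp_sub, exp_neg, exp_nat_mul_two_pi_mul_I, inv_one, one_div, zeta8]

theorem hasSum_exp_freq {v : ℝ} (hv : 0 < v) :
    HasSum (fun k : ℕ => exp (-(2 * π * freq k * v))) (I / (2 * sin (π * (zeta8 * v)))) := by
  obtain ⟨x, hx⟩ : ∃ x : ℂ, x = π * (zeta8 * v) := ⟨_, rfl⟩
  have him : 0 < x.im := by
    rw [hx, im_ofReal_mul, zeta8_mul_im, ofReal_re, ofReal_im, add_zero]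
    positivity
  have hlt : ‖exp (2 * x * I)‖ < 1 := by
    simpa [norm_exp] using him
  have hsin : sin x ≠ 0 := norm_pos_iff.1 (him.trans_le ((le_abs_self _).trans
    (abs_im_le_norm_sin x)))
  have hterm (k : ℕ) :
      exp (-(2 * π * freq k * v)) = exp (x * I) * exp (2 * x * I) ^ k := by
    rw [← exp_nat_mul, ← exp_add, freq_eq, hx]
    push_cast
    ring_nf
  have hvalue : I / (2 * sin x) = exp (x * I) * (1 - exp (2 * x * I))⁻¹ := by
    have hne : 1 - exp (2 * x * I) ≠ 0 := fun h => by simp [← sub_eq_zero.1 h] at hlt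
    have hinv : exp (x * I) * exp (-x * I) = 1 := by rw [← exp_add]; simp
    have hsq : exp (2 * x * I) = exp (x * I) * exp (x * I) := by rw [← exp_add]; ring_nf
    rw [← div_eq_mul_inv, div_eq_div_iff (by simpa using hsin) hne, Complex.sin, hsq]
    linear_combination (-I) * hinv
  rw [← hx, hvalue]
  simp_rw [hterm]
  exact (hasSum_geometric_of_norm_lt_one hlt).mul_left _

theorem norm_cpow_mul_exp_freq_le (l : ℂ) (k : ℕ) {v : ℝ} (hv : 0 < v) :
    ‖(v : ℂ) ^ (l - 1) * exp (-(π * v ^ 2) - 2 * π * freq k * v)‖ ≤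
      v ^ (l.re - 1) * Real.exp (-((k + 1) * v)) := by
  have hsqrt : 1.4 ≤ √2 := Real.le_sqrt_of_sq_le (by norm_num)
  have hre : (-(π * v ^ 2) - 2 * π * freq k * v : ℂ).re =
      -(π * v ^ 2) - π * √2 * (k + 1 / 2) * v := by
    rw [sub_re, ← ofReal_pow, ← ofReal_mul, neg_re, ofReal_re, re_mul_ofReal, ← ofReal_ofNat,
      ← ofReal_mul, re_ofReal_mul, freq_re]
    ring
  rw [norm_mul, norm_cpow_eq_rpow_re_of_pos hv, norm_exp, hre, sub_re, one_re]
  gcongr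
  have hpi : 2 ≤ π * √2 := by nlinarith [Real.pi_gt_three]
  calc -(π * v ^ 2) - π * √2 * (k + 1 / 2) * v ≤ 0 - 2 * (k + 1 / 2) * v := by
        gcongr
        rw [Left.neg_nonpos_iff]
        positivity
    _ ≤ -((k + 1) * v) := by nlinarith [(k.cast_nonneg : (0 : ℝ) ≤ k)]

theorem aestronglyMeasurable_cpow_mul_exp_freq (l : ℂ) (k : ℕ) :
    AEStronglyMeasurable
      (fun v : ℝ => (v : ℂ) ^ (l - 1) * exp (-(π * v ^ 2) - 2 * π * freq k * v))
      (volume.restrict (Ioi 0)) := by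
  refine ContinuousOn.aestronglyMeasurable (ContinuousOn.mul (fun t ht => ?_) (by fun_prop))
    measurableSet_Ioi
  exact (continuousAt_ofReal_cpow_const t _ (Or.inr (ne_of_gt ht))).continuousWithinAt

theorem integrableOn_cpow_mul_exp_freq {l : ℂ} (hl : 0 < l.re) (k : ℕ) :
    IntegrableOn (fun v : ℝ => (v : ℂ) ^ (l - 1) * exp (-(π * v ^ 2) - 2 * π * freq k * v))
      (Ioi 0) :=
  (integrableOn_rpow_mul_exp_neg_mul (r := l.re - 1) (b := k + 1) (by linarith)
    (by positivity)).mono' (aestronglyMeasurable_cpow_mul_exp_freq l k)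
    ((ae_restrict_mem measurableSet_Ioi).mono fun _ => norm_cpow_mul_exp_freq_le l k)

theorem summable_integral_norm_cpow_mul_exp_freq {l : ℂ} (hl : 1 < l.re) :
    Summable fun k : ℕ => ∫ v in Ioi (0 : ℝ),
      ‖(v : ℂ) ^ (l - 1) * exp (-(π * v ^ 2) - 2 * π * freq k * v)‖ := by
  have hl₀ : 0 < l.re := one_pos.trans hl
  have hzeta : Summable fun k : ℕ => 1 / ((k : ℝ) + 1) ^ l.re * Real.Gamma l.re := by
    refine Summable.mul_right _ ?_
    simpa using (summable_nat_add_iff 1).2 (Real.summable_one_div_nat_rpow.2 hl)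
  refine hzeta.of_nonneg_of_le (fun k => integral_nonneg fun _ => norm_nonneg _) fun k => ?_
  have hk : (0 : ℝ) < k + 1 := by positivity
  refine (setIntegral_mono_on (integrableOn_cpow_mul_exp_freq hl₀ k).norm
    (integrableOn_rpow_mul_exp_neg_mul (by linarith) hk) measurableSet_Ioi
    fun _ => norm_cpow_mul_exp_freq_le l k).trans_eq ?_
  rw [Real.integral_rpow_mul_exp_neg_mul_Ioi hl₀ hk, Real.div_rpow zero_le_one hk.le,
    Real.one_rpow]

theorem tsum_cpow_mul_exp_freq (l : ℂ) {v : ℝ} (hv : 0 < v) :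
    ∑' k : ℕ, (v : ℂ) ^ (l - 1) * exp (-(π * v ^ 2) - 2 * π * freq k * v) =
      I / 2 * ((v : ℂ) ^ (l - 1) * rayKernel v) := by
  simp_rw [sub_eq_add_neg (-(π * (v : ℂ) ^ 2)), exp_add, tsum_mul_left,
    (hasSum_exp_freq hv).tsum_eq, rayKernel]
  ring

/-- The common factor of all terms in the expansion of `mellin rayKernel l` into vertical
integrals. -/
noncomputable def mellinPrefactor (l : ℂ) : ℂ :=
  -(2 * I) * zeta8⁻¹ * (2 * π : ℝ) ^ (-l) * Gamma l

theorem hasSum_mellin_rayKernel {l : ℂ} (hl : 1 < l.re) {D : ℕ → ℝ} (hD : ∀ k, 0 < D k) :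
    HasSum (fun k => mellinPrefactor l * verticalIntegral l (freq k) (D k))
      (mellin rayKernel l) := by
  have hl₀ : 0 < l.re := one_pos.trans hl
  have hsum := (hasSum_integral_of_summable_integral_norm
    (integrableOn_cpow_mul_exp_freq hl₀)
    (summable_integral_norm_cpow_mul_exp_freq hl)).mul_left (-(2 * I))
  have htotal : -(2 * I) * ∫ v in Ioi (0 : ℝ),
      ∑' k : ℕ, (v : ℂ) ^ (l - 1) * exp (-(π * v ^ 2) - 2 * π * freq k * v) =
      mellin rayKernel l := by
    rw [setIntegral_congr_fun measurableSet_Ioi fun v hv => tsum_cpow_mul_exp_freq l hv,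
      integral_const_mul, mellin]
    simp_rw [smul_eq_mul]
    linear_combination
      -(∫ v in Ioi (0 : ℝ), (v : ℂ) ^ (l - 1) * rayKernel v) * I_sq
  rw [htotal] at hsum
  refine hsum.congr_fun fun k => ?_
  rw [integral_cpow_mul_gaussian hl₀ (freq k) (hD k), exp_pi_mul_freq_sq, mellinPrefactor]
  ring

theorem le_apply_zero_of_hasDerivAt_neg_mul {f c : ℝ → ℝ}
    (hf : ∀ v, HasDerivAt f (-(v * c v)) v) (hc : ∀ v, 0 ≤ c v) (v : ℝ) : f v ≤ f 0 := by
  have hcont : Continuous f := continuous_iff_continuousAt.2 fun v => (hf v).continuousAt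
  have hdiff : Differentiable ℝ f := fun v => (hf v).differentiableAt
  rcases le_total 0 v with hv | hv
  · refine antitoneOn_of_deriv_nonpos (convex_Ici (0 : ℝ)) hcont.continuousOn
      hdiff.differentiableOn (fun x hx => ?_) self_mem_Ici hv hv
    rw [interior_Ici] at hx
    rw [(hf x).deriv, Left.neg_nonpos_iff]
    exact mul_nonneg hx.out.le (hc x)
  · refine monotoneOn_of_deriv_nonneg (convex_Iic (0 : ℝ)) hcont.continuousOn
      hdiff.differentiableOn (fun x hx => ?_) hv self_mem_Iic hv
    rw [interior_Iic] at hx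
    rw [(hf x).deriv, ← neg_mul]
    exact mul_nonneg (neg_nonneg.2 hx.out.le) (hc x)

/-- The exponent of the integrand of `verticalIntegral`. -/
noncomputable def phase (l κ w : ℂ) : ℂ := -l * log w + π * w ^ 2 - 2 * π * κ * w

theorem exp_phase {w : ℂ} (hw : w ≠ 0) (l κ : ℂ) :
    exp (phase l κ w) = w ^ (-l) * exp (π * w ^ 2 - 2 * π * κ * w) := by
  rw [cpow_def_of_ne_zero hw, ← exp_add, phase]
  ring_nf

theorem add_mul_I_mem_slitPlane {w₀ : ℂ} (hw : 0 < w₀.re) (v : ℝ) : w₀ + v * I ∈ slitPlane :=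
  Or.inl (by simpa using hw)

theorem hasDerivAt_add_mul_I (w₀ : ℂ) (v : ℝ) : HasDerivAt (fun v : ℝ => w₀ + v * I) I v := by
  simpa using ((hasDerivAt_id v).ofReal_comp.mul_const I).const_add w₀

theorem verticalIntegral_eq_integral_exp_phase {w₀ : ℂ} (hw : 0 < w₀.re) (l κ : ℂ) :
    verticalIntegral l κ w₀.re = ∫ v : ℝ, exp (phase l κ (w₀ + v * I)) := by
  rw [verticalIntegral, ← integral_add_right_eq_self (μ := volume) _ w₀.im]
  refine integral_congr_ae (Eventually.of_forall fun v => ?_)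
  have hline : (w₀.re : ℂ) + (v + w₀.im : ℝ) * I = w₀ + v * I := by
    rw [ofReal_add, add_mul, add_left_comm, re_add_im, add_comm]
  simp only [hline, exp_phase (slitPlane_ne_zero (add_mul_I_mem_slitPlane hw v))]

/-- The parameters `l = 2 π w₀ m` and `κ = w₀ - m` are those for which `w₀` and `-m` are the two
saddle points of `phase l κ`. -/
theorem hasDerivAt_phase_add_mul_I {w₀ : ℂ} (hw : 0 < w₀.re) (m : ℂ) (v : ℝ) :
    HasDerivAt (fun v : ℝ => phase (2 * π * (w₀ * m)) (w₀ - m) (w₀ + v * I))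
      (-(2 * π * v : ℝ) * (1 + m / (w₀ + v * I))) v := by
  have hline := hasDerivAt_add_mul_I w₀ v
  have hslit := add_mul_I_mem_slitPlane hw v
  have hne := slitPlane_ne_zero hslit
  refine ((((hline.clog_real hslit).const_mul (-(2 * π * (w₀ * m)))).add
    ((hline.pow 2).const_mul (π : ℂ))).sub (hline.const_mul (2 * π * (w₀ - m)))).congr_deriv ?_
  have hvI : (v : ℂ) * I = (w₀ + v * I) - w₀ := by ring
  generalize w₀ + v * I = w at hvI hne ⊢
  rw [Nat.add_one_sub_one, pow_one]
  push_cast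
  field_simp
  linear_combination (v * (w + m)) * I_sq - (I * (w + m)) * hvI

/-- Inversion maps the line `re z = x` to the circle with diameter `[0, 1 / x]`. -/
theorem norm_inv_sub_inv_two_mul_re {z : ℂ} (hz : 0 < z.re) :
    ‖z⁻¹ - ((2 * z.re : ℝ) : ℂ)⁻¹‖ = (2 * z.re)⁻¹ := by
  have hne : z ≠ 0 := fun h => hz.ne' (by simp [h])
  have hre : ((2 * z.re : ℝ) : ℂ) ≠ 0 := ofReal_ne_zero.2 (by positivity)
  have hconj : ((2 * z.re : ℝ) : ℂ) - z = (starRingEnd ℂ) z := by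
    rw [sub_eq_iff_eq_add', add_conj]
  rw [inv_sub_inv hne hre, hconj, norm_div, norm_conj, norm_mul, norm_real,
    Real.norm_of_nonneg (by positivity), div_mul_cancel_left₀ (norm_ne_zero_iff.2 hne)]

theorem neg_norm_sub_re_div_le_re_div (m : ℂ) {z : ℂ} (hz : 0 < z.re) :
    -((‖m‖ - m.re) / (2 * z.re)) ≤ (m / z).re := by
  have hnorm : |(m * (z⁻¹ - ((2 * z.re : ℝ) : ℂ)⁻¹)).re| ≤ ‖m‖ * (2 * z.re)⁻¹ := by
    refine (abs_re_le_norm _).trans_eq ?_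
    rw [norm_mul, norm_inv_sub_inv_two_mul_re hz]
  have hre : (m * (z⁻¹ - ((2 * z.re : ℝ) : ℂ)⁻¹)).re = (m / z).re - m.re * (2 * z.re)⁻¹ := by
    rw [mul_sub, sub_re, ← div_eq_mul_inv, ← ofReal_inv, re_mul_ofReal]
  rw [hre] at hnorm
  rw [div_eq_mul_inv, sub_mul]
  linarith [(abs_le.1 hnorm).1]

theorem sub_one_le_re_div_add_mul_I {w₀ m : ℂ} (hw : 0 < w₀.re) {c : ℝ}
    (hm : ‖m‖ - m.re ≤ 2 * (1 - c) * w₀.re) (v : ℝ) : c - 1 ≤ (m / (w₀ + v * I)).re := by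
  have hre : (w₀ + v * I).re = w₀.re := by simp
  refine le_trans ?_ (neg_norm_sub_re_div_le_re_div m (by rwa [hre]))
  rw [hre, le_neg, neg_sub, div_le_iff₀ (by positivity)]
  linarith

/-- On a vertical line through the saddle point `w₀` the integrand decays at least like a Gaussian,
provided the other saddle point `-m` does not interfere. -/
theorem norm_exp_phase_add_mul_I_le {w₀ m : ℂ} (hw : 0 < w₀.re) {c : ℝ}
    (hm : ‖m‖ - m.re ≤ 2 * (1 - c) * w₀.re) (v : ℝ) :
    ‖exp (phase (2 * π * (w₀ * m)) (w₀ - m) (w₀ + v * I))‖ ≤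
      ‖exp (phase (2 * π * (w₀ * m)) (w₀ - m) w₀)‖ * Real.exp (-(c * π) * v ^ 2) := by
  have hderiv (v : ℝ) : HasDerivAt
      (fun v : ℝ => (phase (2 * π * (w₀ * m)) (w₀ - m) (w₀ + v * I)).re + c * π * v ^ 2)
      (-(v * (2 * π * (1 - c + (m / (w₀ + v * I)).re)))) v := by
    have hre : HasDerivAt
        (fun v : ℝ => (phase (2 * π * (w₀ * m)) (w₀ - m) (w₀ + v * I)).re) _ v :=
      reCLM.hasFDerivAt.comp_hasDerivAt v (hasDerivAt_phase_add_mul_I hw m v)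
    refine (hre.add ((hasDerivAt_pow 2 v).const_mul (c * π))).congr_deriv ?_
    rw [reCLM_apply, ← ofReal_neg, re_ofReal_mul, add_re, one_re]
    push_cast
    ring
  have hle := le_apply_zero_of_hasDerivAt_neg_mul hderiv
    (fun v => mul_nonneg Real.two_pi_pos.le (by linarith [sub_one_le_re_div_add_mul_I hw hm v])) v
  simp only [ofReal_zero, zero_mul, add_zero, ne_eq, OfNat.ofNat_ne_zero, not_false_eq_true,
    zero_pow, mul_zero] at hle
  rw [norm_exp, norm_exp, ← Real.exp_add, Real.exp_le_exp]
  linarith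

theorem norm_verticalIntegral_le {w₀ m : ℂ} (hw : 0 < w₀.re) {c : ℝ} (hc : 0 < c)
    (hm : ‖m‖ - m.re ≤ 2 * (1 - c) * w₀.re) :
    ‖verticalIntegral (2 * π * (w₀ * m)) (w₀ - m) w₀.re‖ ≤
      ‖exp (phase (2 * π * (w₀ * m)) (w₀ - m) w₀)‖ * √(1 / c) := by
  rw [verticalIntegral_eq_integral_exp_phase hw]
  refine (norm_integral_le_of_norm_le
    ((integrable_exp_neg_mul_sq (by positivity : 0 < c * π)).const_mul _)
    (Eventually.of_forall fun v => norm_exp_phase_add_mul_I_le hw hm v)).trans_eq ?_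
  rw [integral_const_mul, integral_gaussian, div_mul_cancel_right₀ Real.pi_ne_zero, one_div]

theorem re_cpow_inv_two_pos {z : ℂ} (hz : z ∈ slitPlane) : 0 < (z ^ (2⁻¹ : ℂ)).re := by
  rw [cpow_inv_two_re]
  refine Real.sqrt_pos.2 (half_pos ?_)
  rcases hz with hre | him
  · positivity
  · linarith [neg_abs_le z.re, abs_re_lt_norm.2 him]

/-- The root of `z² = K² + 4 η²` in the right half-plane. -/
noncomputable def discRoot (η : ℂ) (K : ℝ) : ℂ := ((K : ℂ) ^ 2 + 4 * η ^ 2) ^ (2⁻¹ : ℂ)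

/-- The saddle point of `phase l κ` in the right half-plane, for `l = 2 π (η / e^{π i / 4})²` and
`κ = K / e^{π i / 4}`. -/
noncomputable def saddle (η : ℂ) (K : ℝ) : ℂ := (K + discRoot η K) / (2 * zeta8)

/-- The negative of the second saddle point of `phase l κ`, for the same `l` and `κ` as in
`saddle`. -/
noncomputable def coSaddle (η : ℂ) (K : ℝ) : ℂ := (discRoot η K - K) / (2 * zeta8)

theorem discRoot_sq (η : ℂ) (K : ℝ) : discRoot η K ^ 2 = K ^ 2 + 4 * η ^ 2 :=
  cpow_ofNat_inv_pow _ 2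

theorem discRoot_re_mul_im (η : ℂ) (K : ℝ) :
    (discRoot η K).re * (discRoot η K).im = 4 * (η.re * η.im) := by
  have him := congrArg im (discRoot_sq η K)
  simp only [pow_two, mul_im, add_im, ofReal_re, ofReal_im, re_ofNat, im_ofNat, mul_zero, zero_mul,
    add_zero] at him
  linarith

theorem discRoot_re_sq_sub_im_sq (η : ℂ) (K : ℝ) :
    (discRoot η K).re ^ 2 - (discRoot η K).im ^ 2 = K ^ 2 + 4 * (η.re ^ 2 - η.im ^ 2) := by
  have hre := congrArg re (discRoot_sq η K)
  simp only [pow_two, mul_re, add_re, ofReal_re, ofReal_im, re_ofNat, im_ofNat, mul_zero, zero_mul,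
    sub_zero] at hre
  linarith

theorem saddle_sub_coSaddle (η : ℂ) (K : ℝ) : saddle η K - coSaddle η K = K / zeta8 := by
  have := zeta8_ne_zero
  rw [saddle, coSaddle]
  field_simp
  ring

theorem saddle_mul_coSaddle (η : ℂ) (K : ℝ) : saddle η K * coSaddle η K = (η / zeta8) ^ 2 := by
  have := zeta8_ne_zero
  rw [saddle, coSaddle]
  field_simp
  linear_combination discRoot_sq η K

theorem div_zeta8_re (z : ℂ) : (z / zeta8).re = √2 / 2 * (z.re + z.im) := by
  rw [div_eq_mul_inv, inv_zeta8, mul_neg, neg_re, mul_re, I_mul_re, I_mul_im, zeta8_re, zeta8_im]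
  ring

theorem div_zeta8_im (z : ℂ) : (z / zeta8).im = √2 / 2 * (z.im - z.re) := by
  rw [div_eq_mul_inv, inv_zeta8, mul_neg, neg_im, mul_im, I_mul_re, I_mul_im, zeta8_re, zeta8_im]
  ring

theorem div_two_mul_zeta8_re (z : ℂ) : (z / (2 * zeta8)).re = √2 / 4 * (z.re + z.im) := by
  rw [mul_comm, ← div_div, ← ofReal_ofNat, div_ofReal_re, div_zeta8_re]
  ring

theorem saddle_re (η : ℂ) (K : ℝ) :
    (saddle η K).re = √2 / 4 * (K + (discRoot η K).re + (discRoot η K).im) := by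
  rw [saddle, div_two_mul_zeta8_re, add_re, add_im, ofReal_re, ofReal_im, zero_add]

theorem coSaddle_re (η : ℂ) (K : ℝ) :
    (coSaddle η K).re = √2 / 4 * ((discRoot η K).re - K + (discRoot η K).im) := by
  rw [coSaddle, div_two_mul_zeta8_re, sub_re, sub_im, ofReal_re, ofReal_im, sub_zero]

section FirstQuadrant

variable {η : ℂ} (hre : 0 < η.re) (him : 0 < η.im)
include hre him

theorem disc_mem_slitPlane (K : ℝ) : (K : ℂ) ^ 2 + 4 * η ^ 2 ∈ slitPlane := by
  right
  have himag : ((K : ℂ) ^ 2 + 4 * η ^ 2).im = 8 * (η.re * η.im) := by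
    simp only [pow_two, mul_im, add_im, ofReal_re, ofReal_im, re_ofNat, im_ofNat, mul_zero,
      zero_mul, add_zero]
    ring
  rw [himag]
  positivity

theorem discRoot_re_pos (K : ℝ) : 0 < (discRoot η K).re :=
  re_cpow_inv_two_pos (disc_mem_slitPlane hre him K)

theorem discRoot_im_pos (K : ℝ) : 0 < (discRoot η K).im := by
  refine pos_of_mul_pos_right ?_ (discRoot_re_pos hre him K).le
  rw [discRoot_re_mul_im]
  positivity

theorem discRoot_re_le {K : ℝ} (hK : 0 ≤ K) : (discRoot η K).re ≤ K + 2 * η.re := by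
  have hmul := discRoot_re_mul_im η K
  have hsq := discRoot_re_sq_sub_im_sq η K
  by_contra! hlt
  have him_lt : (discRoot η K).im < 2 * η.im := by
    refine lt_of_mul_lt_mul_left ?_ (discRoot_re_pos hre him K).le
    nlinarith [mul_pos (sub_pos.2 hlt) him, mul_nonneg hK him.le]
  nlinarith [mul_nonneg hK hre.le, discRoot_im_pos hre him K]

theorem le_discRoot_im {K : ℝ} (hK : 0 ≤ K) :
    4 * (η.re * η.im) / (K + 2 * η.re) ≤ (discRoot η K).im := by
  rw [div_le_iff₀ (by positivity), ← discRoot_re_mul_im η K, mul_comm]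
  exact mul_le_mul_of_nonneg_left (discRoot_re_le hre him hK) (discRoot_im_pos hre him K).le

theorem discRoot_zero : discRoot η 0 = 2 * η := by
  have hfactor : (discRoot η 0 - 2 * η) * (discRoot η 0 + 2 * η) = 0 := by
    have hsq := discRoot_sq η 0
    rw [ofReal_zero] at hsq
    linear_combination hsq
  refine sub_eq_zero.1 ((mul_eq_zero.1 hfactor).resolve_right fun h => ?_)
  have hsum := congrArg re h
  rw [add_re, ← ofReal_ofNat, re_ofReal_mul, zero_re] at hsum
  linarith [discRoot_re_pos hre him 0]

theorem saddle_zero : saddle η 0 = η / zeta8 := by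
  rw [saddle, discRoot_zero hre him, ofReal_zero, zero_add, mul_div_mul_left _ _ two_ne_zero]

theorem saddle_re_pos {K : ℝ} (hK : 0 ≤ K) : 0 < (saddle η K).re := by
  have := discRoot_re_pos hre him K
  have := discRoot_im_pos hre him K
  rw [saddle_re]
  positivity

theorem norm_coSaddle_sub_re_le (hratio : η.im ≤ 10 * η.re) {K : ℝ} (hK : 0 ≤ K) :
    ‖coSaddle η K‖ - (coSaddle η K).re ≤ 3 / 2 * (saddle η K).re := by
  have hmul := discRoot_re_mul_im η K
  have hsub := discRoot_re_sq_sub_im_sq η K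
  have hx := discRoot_re_pos hre him K
  have hy := discRoot_im_pos hre him K
  have hnorm : ‖coSaddle η K‖ = ‖discRoot η K - K‖ / 2 := by
    rw [coSaddle, norm_div, norm_mul, norm_zeta8, Complex.norm_ofNat, mul_one]
  have hroot : ‖discRoot η K - K‖ ^ 2 =
      ((discRoot η K).re - K) ^ 2 + (discRoot η K).im ^ 2 := by
    rw [← normSq_eq_norm_sq, normSq_apply, sub_re, sub_im, ofReal_re, ofReal_im, sub_zero]
    ring
  rw [hnorm, saddle_re, coSaddle_re]
  generalize (discRoot η K).re = x at *
  generalize (discRoot η K).im = y at *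
  have hle : ‖discRoot η K - K‖ ≤ √2 * ((5 * x + K + 5 * y) / 4) := by
    refine abs_le_of_sq_le_sq' ?_ (by positivity) |>.2
    rw [hroot, mul_pow, Real.sq_sqrt zero_le_two]
    have hη : η.im ^ 2 - η.re ^ 2 ≤ 9.9 * (η.re * η.im) := by
      nlinarith [mul_nonneg (sub_nonneg.2 hratio) (by positivity : 0 ≤ η.im + 0.1 * η.re)]
    nlinarith [mul_nonneg hx.le hK, mul_nonneg hy.le hK, mul_pos hx hy, sq_nonneg x, sq_nonneg y]
  linarith

theorem differentiableAt_saddle (K : ℝ) : DifferentiableAt ℝ (saddle η) K := by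
  have hroot : DifferentiableAt ℂ (fun z : ℂ => (z ^ 2 + 4 * η ^ 2) ^ (2⁻¹ : ℂ)) K :=
    DifferentiableAt.cpow_const (by fun_prop) (disc_mem_slitPlane hre him K)
  exact ((differentiableAt_id.add hroot).div_const
    (2 * zeta8)).hasDerivAt.comp_ofReal.differentiableAt

/-- The saddle point being stationary, only the explicit dependence of `phase` on `K`
contributes. -/
theorem hasDerivAt_re_phase_saddle {K : ℝ} (hK : 0 ≤ K) :
    HasDerivAt (fun K : ℝ => (phase (2 * π * (η / zeta8) ^ 2) (K / zeta8) (saddle η K)).re)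
      (-(π * (discRoot η K).im)) K := by
  have hsaddle := (differentiableAt_saddle hre him K).hasDerivAt
  generalize deriv (saddle η) K = saddle' at hsaddle
  have hslit : saddle η K ∈ slitPlane := Or.inl (saddle_re_pos hre him hK)
  have hfreq : HasDerivAt (fun K : ℝ => K / zeta8) (((1 : ℝ) : ℂ) / zeta8) K :=
    (hasDerivAt_id K).ofReal_comp.div_const zeta8
  have hphase := (((hsaddle.clog_real hslit).const_mul (-(2 * π * (η / zeta8) ^ 2))).add
    ((hsaddle.pow 2).const_mul (π : ℂ))).sub ((hfreq.const_mul (2 * π : ℂ)).mul hsaddle)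
  have hvalue : -(2 * π * (η / zeta8) ^ 2) * (saddle' / saddle η K) +
      π * ((2 : ℕ) * saddle η K ^ (2 - 1) * saddle') -
      (2 * π * ((1 : ℝ) / zeta8) * saddle η K + 2 * π * (K / zeta8) * saddle') =
      -π * ((K + discRoot η K) / I) := by
    have hroot : (K : ℂ) + discRoot η K = 2 * zeta8 * saddle η K := by
      rw [saddle, mul_div_cancel₀ _ (mul_ne_zero two_ne_zero zeta8_ne_zero)]
    rw [← saddle_mul_coSaddle η K, ← saddle_sub_coSaddle η K, ← zeta8_sq, hroot]
    have := zeta8_ne_zero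
    have := slitPlane_ne_zero hslit
    field_simp
    push_cast
    ring
  refine (reCLM.hasFDerivAt.comp_hasDerivAt K hphase).congr_deriv ?_
  rw [reCLM_apply, show (π : ℂ) = ((π : ℝ) : ℂ) from rfl]
  refine (congrArg re hvalue).trans ?_
  rw [div_I, ← ofReal_neg, re_ofReal_mul, neg_re, mul_I_re, add_im, ofReal_im]
  ring

theorem antitoneOn_re_phase_saddle_add_log :
    AntitoneOn (fun K : ℝ =>
      (phase (2 * π * (η / zeta8) ^ 2) (K / zeta8) (saddle η K)).re +
        4 * π * (η.re * η.im) * Real.log (K + 2 * η.re)) (Ici 0) := by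
  have hderiv (K : ℝ) (hK : 0 ≤ K) : HasDerivAt (fun K : ℝ =>
      (phase (2 * π * (η / zeta8) ^ 2) (K / zeta8) (saddle η K)).re +
        4 * π * (η.re * η.im) * Real.log (K + 2 * η.re))
      (-(π * (discRoot η K).im) + 4 * π * (η.re * η.im) * (1 / (K + 2 * η.re))) K :=
    (hasDerivAt_re_phase_saddle hre him hK).add
      ((((hasDerivAt_id K).add_const _).log (ne_of_gt (by simp only [id]; positivity))).const_mul _)
  refine antitoneOn_of_deriv_nonpos (convex_Ici 0)
    (fun K hK => (hderiv K hK).continuousAt.continuousWithinAt)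
    (fun K hK => (hderiv K (interior_subset hK)).differentiableAt.differentiableWithinAt)
    fun K hK => ?_
  have hK : 0 ≤ K := interior_subset hK
  calc deriv _ K = π * (4 * (η.re * η.im) / (K + 2 * η.re) - (discRoot η K).im) := by
        rw [(hderiv K hK).deriv]; ring
    _ ≤ 0 := mul_nonpos_of_nonneg_of_nonpos Real.pi_pos.le
        (sub_nonpos.2 (le_discRoot_im hre him hK))

theorem norm_exp_phase_saddle_le {K : ℝ} (hK : 0 ≤ K) :
    ‖exp (phase (2 * π * (η / zeta8) ^ 2) (K / zeta8) (saddle η K))‖ ≤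
      ‖exp (phase (2 * π * (η / zeta8) ^ 2) 0 (η / zeta8))‖ *
        (1 + K / (2 * η.re)) ^ (-(4 * π * (η.re * η.im))) := by
  have hmono := antitoneOn_re_phase_saddle_add_log hre him self_mem_Ici hK hK
  have hpos : 0 < 1 + K / (2 * η.re) := by positivity
  have hlog : Real.log (K + 2 * η.re) = Real.log (1 + K / (2 * η.re)) + Real.log (2 * η.re) := by
    rw [← Real.log_mul hpos.ne' (by positivity)]
    congr 1
    field_simp
    ring
  simp only [saddle_zero hre him, ofReal_zero, zero_div, zero_add, hlog] at hmono
  rw [norm_exp, norm_exp, Real.rpow_def_of_pos hpos, ← Real.exp_add, Real.exp_le_exp]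
  linarith

end FirstQuadrant

theorem exp_pi_mul_le_one_add_rpow {a b K : ℝ} (ha : 3 / 4 ≤ a) (hb : 0 ≤ b) (hK : 3 / 2 ≤ K) :
    Real.exp (π * b) ≤ (1 + K / (2 * a)) ^ (2 * (π * (a * b))) := by
  have ha₀ : 0 < a := by linarith
  have hlog : 1 / (2 * a) ≤ Real.log (1 + K / (2 * a)) := by
    refine le_trans ?_ (Real.le_log_one_add_of_nonneg (by positivity : 0 ≤ K / (2 * a)))
    rw [div_le_div_iff₀ (by positivity) (by positivity)]
    field_simp
    nlinarith
  rw [Real.rpow_def_of_pos (by positivity), Real.exp_le_exp]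
  calc π * b = 1 / (2 * a) * (2 * (π * (a * b))) := by field_simp
    _ ≤ Real.log (1 + K / (2 * a)) * (2 * (π * (a * b))) := by gcongr

theorem mul_le_one_add_rpow {a b K : ℝ} (ha : 0 < a) (hab : 1 ≤ π * (a * b)) (hK : 0 ≤ K) :
    π * b / 2 * K ≤ (1 + K / (2 * a)) ^ (π * (a * b)) := by
  have hbernoulli := one_add_mul_self_le_rpow_one_add (s := K / (2 * a))
    (by linarith [show 0 ≤ K / (2 * a) by positivity]) hab
  calc π * b / 2 * K = π * (a * b) * (K / (2 * a)) := by field_simp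
    _ ≤ (1 + K / (2 * a)) ^ (π * (a * b)) := by linarith

theorem one_add_rpow_neg_le {a b K : ℝ} (ha : 3 / 4 ≤ a) (hb : 5 ≤ b) (hK : 3 / 2 ≤ K) :
    (1 + K / (2 * a)) ^ (-(4 * π * (a * b))) ≤ Real.exp (-(π * b)) / (50 * K ^ 2) := by
  have ha₀ : 0 < a := by linarith
  have hK₀ : 0 < K := by linarith
  have hpos : 0 < 1 + K / (2 * a) := by positivity
  have hlinear : 7.5 * K ≤ (1 + K / (2 * a)) ^ (π * (a * b)) := by
    refine le_trans ?_ (mul_le_one_add_rpow ha₀ ?_ hK₀.le)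
    · gcongr
      nlinarith [Real.pi_gt_three]
    · nlinarith [Real.pi_gt_three, mul_le_mul ha hb (by norm_num) ha₀.le]
  have hsplit : (1 + K / (2 * a)) ^ (4 * π * (a * b)) = (1 + K / (2 * a)) ^ (2 * (π * (a * b))) *
      ((1 + K / (2 * a)) ^ (π * (a * b))) ^ 2 := by
    rw [pow_two, ← Real.rpow_add hpos, ← Real.rpow_add hpos]
    ring_nf
  rw [Real.rpow_neg hpos.le, Real.exp_neg, hsplit, div_eq_mul_inv (_⁻¹), ← mul_inv]
  refine inv_anti₀ (by positivity) (mul_le_mul (exp_pi_mul_le_one_add_rpow ha (by linarith) hK) ?_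
    (by positivity) (by positivity))
  calc 50 * K ^ 2 ≤ (7.5 * K) ^ 2 := by nlinarith [sq_nonneg K]
    _ ≤ ((1 + K / (2 * a)) ^ (π * (a * b))) ^ 2 := by gcongr

theorem norm_exp_sub_exp_le {x y : ℂ} {c : ℝ} (hx : x.re ≤ c) (hy : y.re ≤ c) :
    ‖exp x - exp y‖ ≤ Real.exp c * ‖x - y‖ := by
  refine (convex_halfSpace_re_le c).norm_image_sub_le_of_norm_hasDerivWithin_le
    (f := exp) (f' := exp) (fun z _ => (hasDerivAt_exp z).hasDerivWithinAt) (fun z hz => ?_) hy hx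
  rw [norm_exp]
  exact Real.exp_le_exp.2 hz

theorem abs_pow_three_le_half_exp_sq (v : ℝ) : |v| ^ 3 ≤ 1 / 2 * Real.exp (v ^ 2) := by
  have hexp := Real.sum_le_exp_of_nonneg (sq_nonneg |v|) 4
  norm_num [Finset.sum_range_succ, Nat.factorial] at hexp
  rw [← sq_abs v] at hexp ⊢
  generalize |v| = x at hexp ⊢
  nlinarith [mul_nonneg (sq_nonneg x) (sq_nonneg (x - 1)),
    mul_nonneg (sq_nonneg x) (sq_nonneg (x ^ 2 - 2)), sq_nonneg (x ^ 2 - 2)]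

theorem exp_neg_mul_sq_sub_mul {b : ℝ} (hb : b ≠ 0) (c v : ℝ) :
    Real.exp (-b * v ^ 2 - c * v) =
      Real.exp (c ^ 2 / (4 * b)) * Real.exp (-b * (v + c / (2 * b)) ^ 2) := by
  rw [← Real.exp_add]
  congr 1
  field_simp
  ring

theorem integrable_exp_neg_mul_sq_sub_mul {b : ℝ} (hb : 0 < b) (c : ℝ) :
    Integrable fun v : ℝ => Real.exp (-b * v ^ 2 - c * v) := by
  simp_rw [exp_neg_mul_sq_sub_mul hb.ne']
  exact ((integrable_exp_neg_mul_sq hb).comp_add_right _).const_mul _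

theorem integral_exp_neg_mul_sq_sub_mul {b : ℝ} (hb : 0 < b) (c : ℝ) :
    ∫ v : ℝ, Real.exp (-b * v ^ 2 - c * v) = Real.exp (c ^ 2 / (4 * b)) * √(π / b) := by
  simp_rw [exp_neg_mul_sq_sub_mul hb.ne']
  rw [integral_const_mul,
    integral_add_right_eq_self (μ := volume) (fun v : ℝ => Real.exp (-b * v ^ 2)),
    integral_gaussian]

/-- The deviation of `phase (2 π p²) 0` from its quadratic approximation at the saddle point `p`,
on the vertical line through `p`. -/
noncomputable def phaseError (p : ℂ) (v : ℝ) : ℂ :=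
  phase (2 * π * (p * p)) 0 (p + v * I) - phase (2 * π * (p * p)) 0 p + 2 * π * v ^ 2

theorem hasDerivAt_phaseError {p : ℂ} (hp : 0 < p.re) (v : ℝ) :
    HasDerivAt (phaseError p) (2 * π * I * v ^ 2 / (p + v * I)) v := by
  have hphase := hasDerivAt_phase_add_mul_I hp p v
  rw [sub_self] at hphase
  refine ((hphase.sub_const _).add
    (((hasDerivAt_id v).ofReal_comp.pow 2).const_mul (2 * π : ℂ))).congr_deriv ?_
  have hne := slitPlane_ne_zero (add_mul_I_mem_slitPlane hp v)
  have hvI : (v : ℂ) * I = (p + v * I) - p := by ring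
  simp only [id]
  generalize p + v * I = w at hvI hne ⊢
  push_cast
  field_simp
  linear_combination (-v : ℂ) * hvI

theorem norm_phaseError_le {p : ℂ} (hp : 0 < p.re) (v : ℝ) :
    ‖phaseError p v‖ ≤ 2 * π / p.re * |v| ^ 3 := by
  have hderiv (x : ℝ) (hx : x ∈ uIcc 0 v) :
      ‖2 * π * I * x ^ 2 / (p + x * I)‖ ≤ 2 * π / p.re * |v| ^ 2 := by
    have hx : |x| ≤ |v| := by simpa using abs_sub_left_of_mem_uIcc hx
    have hre : p.re ≤ ‖p + x * I‖ := by simpa using re_le_norm (p + x * I)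
    rw [norm_div, norm_mul, norm_mul, norm_mul, norm_I, norm_pow, norm_real, norm_real,
      Complex.norm_ofNat, Real.norm_of_nonneg Real.pi_pos.le, Real.norm_eq_abs, mul_one,
      div_mul_eq_mul_div]
    gcongr
  have hmvt := (convex_uIcc (0 : ℝ) v).norm_image_sub_le_of_norm_hasDerivWithin_le
    (fun x _ => (hasDerivAt_phaseError hp x).hasDerivWithinAt) hderiv left_mem_uIcc right_mem_uIcc
  have hzero : phaseError p 0 = 0 := by simp [phaseError]
  rwa [hzero, sub_zero, sub_zero, Real.norm_eq_abs, mul_assoc, ← pow_succ] at hmvt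

theorem re_neg_two_pi_mul_sq_add_phaseError_le {p : ℂ} (hp : 0 < p.re) (him : |p.im| ≤ p.re)
    (v : ℝ) : (-(2 * π) * (v : ℂ) ^ 2 + phaseError p v).re ≤ -(3 / 4 * π) * v ^ 2 := by
  have hnorm : ‖p‖ ≤ 3 / 2 * p.re := by
    refine (abs_le_of_sq_le_sq' ?_ (by positivity)).2
    rw [← normSq_eq_norm_sq, normSq_apply, ← pow_two p.im, ← sq_abs p.im]
    nlinarith [abs_nonneg p.im]
  have hphase := norm_exp_phase_add_mul_I_le (c := 3 / 4) (m := p) hp (by linarith) v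
  rw [sub_self, norm_exp, norm_exp, ← Real.exp_add, Real.exp_le_exp] at hphase
  rw [phaseError, neg_mul, add_comm, add_neg_cancel_right, sub_re]
  linarith

theorem integral_exp_neg_two_pi_mul_sq_mul_exp (κ : ℂ) :
    ∫ v : ℝ, exp (-(2 * π) * (v : ℂ) ^ 2) * exp (-(2 * π * κ * I) * v) =
      exp (-(π * κ ^ 2 / 2)) / √2 := by
  have hneg : (-(2 * π) : ℂ).re < 0 := by simp [Real.pi_pos]
  have hsqrt : (π / -(-(2 * π)) : ℂ) ^ (1 / 2 : ℂ) = (√2 : ℂ)⁻¹ := by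
    have hhalf : (π / -(-(2 * π)) : ℂ) = ((2⁻¹ : ℝ) : ℂ) := by
      push_cast
      field_simp
    rw [hhalf, ← ofReal_inv, ← Real.sqrt_inv, Real.sqrt_eq_rpow, ofReal_cpow (by norm_num)]
    norm_num
  have hquad := integral_cexp_quadratic hneg (-(2 * π * κ * I)) 0
  simp only [add_zero, exp_add] at hquad
  rw [hquad, hsqrt, mul_comm, div_eq_mul_inv]
  congr 2
  field_simp
  linear_combination (4 * π * κ ^ 2 : ℂ) * I_sq

theorem integrable_exp_neg_two_pi_mul_sq_mul_exp (κ : ℂ) :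
    Integrable fun v : ℝ => exp (-(2 * π) * (v : ℂ) ^ 2) * exp (-(2 * π * κ * I) * v) := by
  have hneg : (-(2 * π) : ℂ).re < 0 := by simp [Real.pi_pos]
  simpa only [add_zero, exp_add] using integrable_cexp_quadratic' hneg (-(2 * π * κ * I)) 0

theorem norm_exp_neg_mul_I_mul_ofReal (κ : ℂ) (v : ℝ) :
    ‖exp (-(2 * π * κ * I) * v)‖ = Real.exp (-(-(2 * π * κ.im) * v)) := by
  rw [norm_exp, re_mul_ofReal]
  simp

theorem norm_exp_phaseError_sub_mul_le {p : ℂ} (hp : 0 < p.re) (him : |p.im| ≤ p.re) (κ : ℂ)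
    (v : ℝ) :
    ‖(exp (-(2 * π) * (v : ℂ) ^ 2 + phaseError p v) - exp (-(2 * π) * (v : ℂ) ^ 2)) *
        exp (-(2 * π * κ * I) * v)‖ ≤
      π / p.re * Real.exp (-(5 / 4) * v ^ 2 - -(2 * π * κ.im) * v) := by
  have hgauss : (-(2 * π) * (v : ℂ) ^ 2).re ≤ -(3 / 4 * π) * v ^ 2 := by
    have hreal : (-(2 * π) * (v : ℂ) ^ 2) = ((-(2 * π) * v ^ 2 : ℝ) : ℂ) := by push_cast; ring
    rw [hreal, ofReal_re]
    nlinarith [mul_nonneg Real.pi_pos.le (sq_nonneg v)]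
  have hdiff := norm_exp_sub_exp_le (re_neg_two_pi_mul_sq_add_phaseError_le hp him v) hgauss
  rw [add_sub_cancel_left] at hdiff
  have herror : ‖phaseError p v‖ ≤ 2 * π / p.re * (1 / 2 * Real.exp (v ^ 2)) :=
    (norm_phaseError_le hp v).trans
      (mul_le_mul_of_nonneg_left (abs_pow_three_le_half_exp_sq v) (by positivity))
  have hexponent : -(3 / 4 * π) * v ^ 2 + v ^ 2 ≤ -(5 / 4) * v ^ 2 := by
    nlinarith [mul_nonneg (sub_nonneg.2 Real.pi_gt_three.le) (sq_nonneg v)]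
  rw [norm_mul, norm_exp_neg_mul_I_mul_ofReal, sub_eq_add_neg (_ * v ^ 2), Real.exp_add,
    ← mul_assoc]
  refine mul_le_mul_of_nonneg_right ?_ (Real.exp_pos _).le
  calc _ ≤ Real.exp (-(3 / 4 * π) * v ^ 2) * (2 * π / p.re * (1 / 2 * Real.exp (v ^ 2))) :=
        hdiff.trans (mul_le_mul_of_nonneg_left herror (Real.exp_pos _).le)
    _ = π / p.re * Real.exp (-(3 / 4 * π) * v ^ 2 + v ^ 2) := by
        rw [Real.exp_add]
        ring
    _ ≤ _ := by gcongr

/-- The Gaussian approximation is centred at the saddle point `p` of `phase (2 π p²) 0`, which the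
frequency `κ` moves only slightly. -/
theorem norm_verticalIntegral_sub_le {p : ℂ} (hp : 0 < p.re) (him : |p.im| ≤ p.re) (κ : ℂ) :
    ‖verticalIntegral (2 * π * p ^ 2) κ p.re -
        exp (phase (2 * π * p ^ 2) 0 p) * exp (-(2 * π * κ * p)) *
          (exp (-(π * κ ^ 2 / 2)) / √2)‖ ≤
      ‖exp (phase (2 * π * p ^ 2) 0 p) * exp (-(2 * π * κ * p))‖ *
        (π / p.re * (Real.exp ((2 * π * κ.im) ^ 2 / 5) * √(π / (5 / 4)))) := by
  rw [pow_two p]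
  set A := exp (phase (2 * π * (p * p)) 0 p) * exp (-(2 * π * κ * p))
  have hintegrand (v : ℝ) : exp (phase (2 * π * (p * p)) κ (p + v * I)) =
      A * (exp (-(2 * π) * (v : ℂ) ^ 2 + phaseError p v) * exp (-(2 * π * κ * I) * v)) := by
    simp only [A, ← exp_add, phaseError, phase]
    ring_nf
  have hcont : Continuous (phaseError p) :=
    continuous_iff_continuousAt.2 fun v => (hasDerivAt_phaseError hp v).continuousAt
  have hdom := (integrable_exp_neg_mul_sq_sub_mul (by norm_num : (0 : ℝ) < 5 / 4)
    (-(2 * π * κ.im))).const_mul (π / p.re)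
  have herror := norm_exp_phaseError_sub_mul_le hp him κ
  have herrorInt : Integrable fun v : ℝ => (exp (-(2 * π) * (v : ℂ) ^ 2 + phaseError p v) -
      exp (-(2 * π) * (v : ℂ) ^ 2)) * exp (-(2 * π * κ * I) * v) :=
    hdom.mono' (Continuous.aestronglyMeasurable (by fun_prop)) (Eventually.of_forall herror)
  have hgauss := integrable_exp_neg_two_pi_mul_sq_mul_exp κ
  have hsplit : ∫ v : ℝ, exp (-(2 * π) * (v : ℂ) ^ 2 + phaseError p v) *
        exp (-(2 * π * κ * I) * v) =
      exp (-(π * κ ^ 2 / 2)) / √2 + ∫ v : ℝ, (exp (-(2 * π) * (v : ℂ) ^ 2 + phaseError p v) -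
        exp (-(2 * π) * (v : ℂ) ^ 2)) * exp (-(2 * π * κ * I) * v) := by
    rw [← integral_exp_neg_two_pi_mul_sq_mul_exp, ← integral_add hgauss herrorInt]
    simp only [← add_mul, add_sub_cancel]
  rw [verticalIntegral_eq_integral_exp_phase hp]
  simp only [hintegrand]
  rw [integral_const_mul, hsplit, ← mul_sub, add_sub_cancel_left, norm_mul]
  refine mul_le_mul_of_nonneg_left ?_ (norm_nonneg _)
  refine (norm_integral_le_of_norm_le hdom (Eventually.of_forall herror)).trans_eq ?_
  rw [integral_const_mul, integral_exp_neg_mul_sq_sub_mul (by norm_num), neg_sq]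
  norm_num

theorem two_pi_mul_freq_zero_mul_div_zeta8 (η : ℂ) :
    2 * π * freq 0 * (η / zeta8) = -(π * I * η) := by
  have hne := zeta8_ne_zero
  simp only [freq, CharP.cast_eq_zero, zero_add]
  push_cast
  field_simp
  rw [zeta8_sq]
  linear_combination η * I_sq

theorem exp_neg_pi_mul_freq_zero_sq_div_two : exp (-(π * freq 0 ^ 2 / 2)) = exp (π * I / 8) := by
  rw [freq_sq]
  congr 1
  push_cast
  ring

theorem pi_div_mul_exp_freq_zero_im_le {x : ℝ} (hx : 36 ≤ x) :
    π / x * (Real.exp ((2 * π * (freq 0).im) ^ 2 / 5) * √(π / (5 / 4))) ≤ 0.4 := by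
  have hpi := Real.pi_lt_d2
  have hpi_pos := Real.pi_pos
  have hexponent : (2 * π * (freq 0).im) ^ 2 / 5 ≤ 1 := by
    rw [freq_im, CharP.cast_eq_zero, mul_neg, neg_sq, mul_pow, mul_pow,
      mul_pow (√2 / 2), div_pow, Real.sq_sqrt zero_le_two]
    nlinarith
  have hexp : Real.exp ((2 * π * (freq 0).im) ^ 2 / 5) ≤ 2.72 :=
    (Real.exp_le_exp.2 hexponent).trans (Real.exp_one_lt_d9.le.trans (by norm_num))
  have hsqrt : √(π / (5 / 4)) ≤ 1.6 := by
    rw [Real.sqrt_le_left (by norm_num)]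
    linarith
  calc π / x * (Real.exp ((2 * π * (freq 0).im) ^ 2 / 5) * √(π / (5 / 4)))
      ≤ 3.15 / 36 * (2.72 * 1.6) := by gcongr
    _ ≤ 0.4 := by norm_num

theorem two_pi_mul_div_zeta8_sq (η : ℂ) :
    2 * π * (η / zeta8) ^ 2 = ((2 * π : ℝ) : ℂ) * -(η ^ 2 * I) := by
  rw [div_pow, zeta8_sq, div_I]
  push_cast
  ring

theorem two_pi_mul_div_zeta8_sq_re (η : ℂ) :
    (2 * π * (η / zeta8) ^ 2).re = 4 * π * (η.re * η.im) := by
  rw [two_pi_mul_div_zeta8_sq, re_ofReal_mul, neg_re, mul_I_re, neg_neg, pow_two, mul_im]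
  ring

/-- The value of the integrand of `verticalIntegral (2 π (η / ζ₈)²) (freq 0)` at the approximate
saddle point `η / ζ₈`, up to a constant phase. -/
noncomputable def saddleAmplitude (η : ℂ) : ℂ :=
  exp (phase (2 * π * (η / zeta8) ^ 2) 0 (η / zeta8)) * exp (π * I * η)

theorem sum_one_div_sq_le (n : ℕ) :
    ∑ k ∈ Finset.range n, 1 / ((k : ℝ) + 1 + 1 / 2) ^ 2 ≤ 1 - 1 / ((n : ℝ) + 1) := by
  induction n with
  | zero => simp
  | succ n ih =>
    have hle : 1 / ((n : ℝ) + 1 + 1 / 2) ^ 2 ≤ 1 / (((n : ℝ) + 1) * (n + 1 + 1)) :=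
      one_div_le_one_div_of_le (by positivity) (by nlinarith)
    have htelescope : 1 / (((n : ℝ) + 1) * (n + 1 + 1)) = 1 / ((n : ℝ) + 1) - 1 / (n + 1 + 1) := by
      field_simp
      ring
    rw [Finset.sum_range_succ, Nat.cast_add_one]
    linarith

theorem sum_one_div_sq_le_one (n : ℕ) :
    ∑ k ∈ Finset.range n, 1 / ((k : ℝ) + 1 + 1 / 2) ^ 2 ≤ 1 :=
  (sum_one_div_sq_le n).trans (sub_le_self _ (by positivity))

section LargeParameter

variable {η : ℂ} (hre : 5 ≤ η.re) (him : 5 ≤ η.im) (hratio : η.im ≤ 10 * η.re)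
include hre him

theorem norm_verticalIntegral_freq_zero_sub_le (hnorm : 2704 ≤ η.re ^ 2 + η.im ^ 2) :
    ‖verticalIntegral (2 * π * (η / zeta8) ^ 2) (freq 0) (η / zeta8).re -
        saddleAmplitude η * (exp (π * I / 8) / √2)‖ ≤ 0.4 * ‖saddleAmplitude η‖ := by
  have hsaddle_re : 36 ≤ (η / zeta8).re := by
    rw [div_zeta8_re]
    refine (abs_le_of_sq_le_sq' (a := 36) ?_ (by positivity)).2
    rw [mul_pow, div_pow, Real.sq_sqrt zero_le_two]
    nlinarith
  have hsaddle_im : |(η / zeta8).im| ≤ (η / zeta8).re := by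
    rw [div_zeta8_re, div_zeta8_im, abs_mul, abs_of_pos (by positivity)]
    refine mul_le_mul_of_nonneg_left ?_ (by positivity)
    rw [abs_le]
    constructor <;> linarith
  have hlead := norm_verticalIntegral_sub_le (by linarith) hsaddle_im (freq 0)
  rw [two_pi_mul_freq_zero_mul_div_zeta8, neg_neg, exp_neg_pi_mul_freq_zero_sq_div_two,
    ← saddleAmplitude] at hlead
  rw [mul_comm 0.4]
  exact hlead.trans
    (mul_le_mul_of_nonneg_left (pi_div_mul_exp_freq_zero_im_le hsaddle_re) (norm_nonneg _))

include hratio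

theorem norm_verticalIntegral_saddle_le {K : ℝ} (hK : 3 / 2 ≤ K) :
    ‖verticalIntegral (2 * π * (η / zeta8) ^ 2) (K / zeta8) (saddle η K).re‖ ≤
      ‖saddleAmplitude η‖ * (1 / 25 * (1 / K ^ 2)) := by
  have hre_pos : 0 < η.re := by linarith
  have him_pos : 0 < η.im := by linarith
  have hK_nonneg : 0 ≤ K := by linarith
  have hline := norm_verticalIntegral_le (c := 1 / 4) (saddle_re_pos hre_pos him_pos hK_nonneg)
    (by norm_num) ((norm_coSaddle_sub_re_le hre_pos him_pos hratio hK_nonneg).trans_eq (by ring))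
  rw [saddle_mul_coSaddle, saddle_sub_coSaddle] at hline
  have hpeak := (norm_exp_phase_saddle_le hre_pos him_pos hK_nonneg).trans
    (mul_le_mul_of_nonneg_left (one_add_rpow_neg_le (by linarith) him hK) (norm_nonneg _))
  have hsqrt : √(1 / (1 / 4)) = 2 := by
    rw [Real.sqrt_eq_iff_mul_self_eq (by norm_num) (by norm_num)]
    norm_num
  have hexp : ‖exp (π * I * η)‖ = Real.exp (-(π * η.im)) := by
    rw [norm_exp]
    congr 1
    simp
  rw [hsqrt] at hline
  rw [saddleAmplitude, norm_mul, hexp]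
  refine (hline.trans (mul_le_mul_of_nonneg_right hpeak zero_le_two)).trans_eq ?_
  have hK_ne : K ≠ 0 := by linarith
  field_simp
  norm_num

theorem norm_tsum_verticalIntegral_le :
    ‖∑' k : ℕ, verticalIntegral (2 * π * (η / zeta8) ^ 2) (freq (k + 1))
        (saddle η (k + 1 + 1 / 2)).re‖ ≤ 0.04 * ‖saddleAmplitude η‖ := by
  have hterm (k : ℕ) : ‖verticalIntegral (2 * π * (η / zeta8) ^ 2) (freq (k + 1))
      (saddle η (k + 1 + 1 / 2)).re‖ ≤
        ‖saddleAmplitude η‖ * (1 / 25 * (1 / ((k : ℝ) + 1 + 1 / 2) ^ 2)) := by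
    have hK : 3 / 2 ≤ (k : ℝ) + 1 + 1 / 2 := by linarith [(Nat.cast_nonneg k : (0 : ℝ) ≤ k)]
    simpa only [freq, Nat.cast_add_one] using
      norm_verticalIntegral_saddle_le hre him hratio hK
  have hnonneg (k : ℕ) : (0 : ℝ) ≤ 1 / ((k : ℝ) + 1 + 1 / 2) ^ 2 := by positivity
  have hsum := (summable_of_sum_range_le hnonneg sum_one_div_sq_le_one).hasSum
  have hle := Real.tsum_le_of_sum_range_le hnonneg sum_one_div_sq_le_one
  refine (tsum_of_norm_bounded ((hsum.mul_left (1 / 25)).mul_left _) hterm).trans ?_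
  rw [mul_comm 0.04]
  refine mul_le_mul_of_nonneg_left ?_ (norm_nonneg _)
  linarith

/-- The term of frequency `freq 0` dominates: its contour runs through its approximate saddle point
`η / ζ₈`, those of the other terms through their exact saddle points. -/
theorem norm_mellin_rayKernel_sub_le (hnorm : 2704 ≤ η.re ^ 2 + η.im ^ 2) :
    ‖mellin rayKernel (2 * π * (η / zeta8) ^ 2) - mellinPrefactor (2 * π * (η / zeta8) ^ 2) *
        (saddleAmplitude η * (exp (π * I / 8) / √2))‖ ≤
      0.44 * ‖mellinPrefactor (2 * π * (η / zeta8) ^ 2) * saddleAmplitude η‖ := by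
  have hre_pos : 0 < η.re := by linarith
  have him_pos : 0 < η.im := by linarith
  set l : ℂ := 2 * π * (η / zeta8) ^ 2
  have hl : 1 < l.re := by
    rw [two_pi_mul_div_zeta8_sq_re]
    have hprod : 25 ≤ η.re * η.im := by nlinarith
    nlinarith [Real.pi_gt_three]
  set D : ℕ → ℝ := fun k => if k = 0 then (η / zeta8).re else (saddle η (k + 1 / 2)).re with hD
  have hD_pos (k : ℕ) : 0 < D k := by
    simp only [hD]
    split_ifs
    · exact saddle_zero hre_pos him_pos ▸ saddle_re_pos hre_pos him_pos le_rfl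
    · exact saddle_re_pos hre_pos him_pos (by positivity)
  have hsum := hasSum_mellin_rayKernel hl hD_pos
  rw [← hsum.tsum_eq, hsum.summable.tsum_eq_zero_add, tsum_mul_left]
  have hzero := norm_verticalIntegral_freq_zero_sub_le hre him hnorm
  have htail := norm_tsum_verticalIntegral_le hre him hratio
  simp only [hD, if_true, Nat.add_eq_zero_iff, one_ne_zero, and_false, if_false, Nat.cast_add_one,
    add_sub_right_comm, ← mul_sub, ← mul_add, norm_mul]
  rw [mul_left_comm]
  refine mul_le_mul_of_nonneg_left ((norm_add_le _ _).trans ?_) (norm_nonneg _)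
  linarith

end LargeParameter

theorem one_sub_eq (s : ℂ) : 1 - s = 2 * π * (eta s / zeta8) ^ 2 := by
  rw [div_pow, eta_sq, zeta8_sq]
  field_simp
  linear_combination (1 - s) * I_sq

theorem eta_div_zeta8 (s : ℂ) : eta s / zeta8 = ((1 - s) / (2 * π)) ^ (2⁻¹ : ℂ) := by
  rw [eta, ← zeta8, mul_div_cancel_left₀ _ zeta8_ne_zero, one_div]

theorem eta_re_mul_im (s : ℂ) : 4 * π * ((eta s).re * (eta s).im) = 1 - s.re := by
  rw [← two_pi_mul_div_zeta8_sq_re, ← one_sub_eq, sub_re, one_re]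

theorem eta_re_sq_sub_im_sq (s : ℂ) : 2 * π * ((eta s).re ^ 2 - (eta s).im ^ 2) = s.im := by
  have him := congrArg im (one_sub_eq s)
  rw [two_pi_mul_div_zeta8_sq, im_ofReal_mul, neg_im, mul_I_im, pow_two, mul_re, sub_im,
    one_im] at him
  linarith

theorem eta_re_sq_add_im_sq (s : ℂ) : 2 * π * ((eta s).re ^ 2 + (eta s).im ^ 2) = ‖s - 1‖ := by
  rw [norm_sub_rev, one_sub_eq s, norm_mul, norm_mul, norm_pow, norm_div, norm_zeta8, div_one,
    ← normSq_eq_norm_sq, normSq_apply, norm_real, Real.norm_of_nonneg Real.pi_pos.le,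
    Complex.norm_ofNat]
  ring

section LeftHalfPlane

variable {s : ℂ} (hs : s.re < 0)
include hs

theorem one_sub_div_two_pi_mem_slitPlane : (1 - s) / (2 * π) ∈ slitPlane := by
  have hdiv : (1 - s) / (2 * π) = (1 - s) / (2 * π : ℝ) := by push_cast; rfl
  refine Or.inl ?_
  rw [hdiv, div_ofReal_re, sub_re, one_re]
  exact div_pos (by linarith) Real.two_pi_pos

theorem eta_div_zeta8_re_pos : 0 < (eta s / zeta8).re := by
  rw [eta_div_zeta8]
  exact re_cpow_inv_two_pos (one_sub_div_two_pi_mem_slitPlane hs)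

theorem eta_re_im_pos : 0 < (eta s).re ∧ 0 < (eta s).im := by
  have hsum : 0 < (eta s).re + (eta s).im := by
    have hre := eta_div_zeta8_re_pos hs
    rw [div_zeta8_re] at hre
    exact (mul_pos_iff_of_pos_left (by positivity)).1 hre
  have hprod : 0 < (eta s).re * (eta s).im := by
    refine pos_of_mul_pos_right ?_ (by positivity : 0 ≤ 4 * π)
    rw [eta_re_mul_im]
    linarith
  rcases mul_pos_iff.1 hprod with hpos | hneg
  · exact hpos
  · linarith [hneg.1, hneg.2]

theorem differentiableAt_eta : DifferentiableAt ℂ eta s := by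
  have hdiff : DifferentiableAt ℂ (fun s : ℂ => (1 - s) / (2 * π)) s := by fun_prop
  exact (hdiff.cpow_const (one_sub_div_two_pi_mem_slitPlane hs)).const_mul _

end LeftHalfPlane

theorem eta_bounds {s : ℂ} (hs : s ∈ G) : 5 ≤ (eta s).re ∧ 5 ≤ (eta s).im ∧
    (eta s).im ≤ 10 * (eta s).re ∧ 2704 ≤ (eta s).re ^ 2 + (eta s).im ^ 2 := by
  obtain ⟨hre, hdist, him_ge, him_le⟩ := hs
  obtain ⟨ha, hb⟩ := eta_re_im_pos hre
  rw [← eta_re_sq_add_im_sq] at hdist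
  rw [← eta_re_mul_im s, ← eta_re_sq_sub_im_sq s] at him_ge him_le
  generalize (eta s).re = a at *
  generalize (eta s).im = b at *
  have hpi := Real.pi_pos
  have hnorm : 2704 ≤ a ^ 2 + b ^ 2 := by nlinarith
  have hquad : 0 ≤ a ^ 2 - b ^ 2 + 9.9 * (a * b) :=
    nonneg_of_mul_nonneg_right (by linarith : 0 ≤ 2 * π * _) Real.two_pi_pos
  have hdiff : 0 ≤ 8 * (a ^ 2 * b ^ 2) - 225 * (a ^ 2 - b ^ 2) :=
    nonneg_of_mul_nonneg_right (by linarith : 0 ≤ 2 * π ^ 2 * _) (by positivity)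
  have hratio : b ≤ 10 * a := by
    by_contra! hlt
    nlinarith [mul_pos (sub_pos.2 hlt) (by positivity : 0 < b + 0.1 * a)]
  refine ⟨?_, ?_, hratio, hnorm⟩
  · by_contra! hlt
    nlinarith
  · by_contra! hlt
    have hb_sq : b ^ 2 < 25 := by nlinarith
    nlinarith [mul_pos (sub_pos.2 hb_sq) (by positivity : 0 < a ^ 2)]

theorem re_lt_neg_one {s : ℂ} (hs : s ∈ G) : s.re < -1 := by
  obtain ⟨hre, him, -, -⟩ := eta_bounds hs
  have hprod : 25 ≤ (eta s).re * (eta s).im := by nlinarith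
  nlinarith [Real.pi_gt_three, eta_re_mul_im s]

theorem norm_sub_one_lt_of_re_eq_zero {s : ℂ} (hre : s.re = 0)
    (hlow : -(99 / 20) * (1 - s.re) ≤ s.im) (hhigh : 225 * π * s.im ≤ (1 - s.re) ^ 2) :
    ‖s - 1‖ < 5408 * π := by
  have hpi := Real.pi_gt_three
  rw [hre] at hlow hhigh
  have him_le : s.im ≤ 1 := by
    by_contra! hlt
    nlinarith
  have him : |s.im| ≤ 5 := abs_le.2 ⟨by linarith, by linarith⟩
  have hnorm := norm_le_abs_re_add_abs_im (s - 1)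
  rw [sub_re, sub_im, hre, one_re, one_im, zero_sub, abs_neg, abs_one, sub_zero] at hnorm
  linarith

theorem isClosed_G : IsClosed G := by
  have hG : G = {s | s.re ≤ 0 ∧ 5408 * π ≤ ‖s - 1‖ ∧ -(99 / 20) * (1 - s.re) ≤ s.im ∧
      225 * π * s.im ≤ (1 - s.re) ^ 2} := by
    ext s
    refine ⟨fun hs => ⟨hs.1.le, hs.2⟩, fun ⟨hre, hdist, hlow, hhigh⟩ =>
      ⟨lt_of_le_of_ne hre fun hzero => ?_, hdist, hlow, hhigh⟩⟩
    exact (norm_sub_one_lt_of_re_eq_zero hzero hlow hhigh).not_ge hdist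
  simp only [hG, ofPred_and]
  exact (isClosed_le (by fun_prop) (by fun_prop)).inter
    ((isClosed_le (by fun_prop) (by fun_prop)).inter
      ((isClosed_le (by fun_prop) (by fun_prop)).inter (isClosed_le (by fun_prop) (by fun_prop))))

theorem norm_mellin_rayKernel_one_sub_sub_le {s : ℂ} (hs : s ∈ G) :
    ‖mellin rayKernel (1 - s) - mellinPrefactor (1 - s) *
        (saddleAmplitude (eta s) * (exp (π * I / 8) / √2))‖ ≤
      0.44 * ‖mellinPrefactor (1 - s) * saddleAmplitude (eta s)‖ := by
  obtain ⟨hre, him, hratio, hnorm⟩ := eta_bounds hs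
  simpa only [← one_sub_eq] using norm_mellin_rayKernel_sub_le hre him hratio hnorm

theorem mellinPrefactor_ne_zero {l : ℂ} (hl : 0 < l.re) : mellinPrefactor l ≠ 0 := by
  have htwo_pi : ((2 * π : ℝ) : ℂ) ≠ 0 := ofReal_ne_zero.2 Real.two_pi_pos.ne'
  exact mul_ne_zero (mul_ne_zero (mul_ne_zero (by simp) (inv_ne_zero zeta8_ne_zero))
    ((cpow_ne_zero_iff_of_exponent_ne_zero (by rintro h; simp [neg_eq_zero.1 h] at hl)).2 htwo_pi))
    (Gamma_ne_zero_of_re_pos hl)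

theorem differentiableAt_mellinPrefactor {l : ℂ} (hl : 0 < l.re) :
    DifferentiableAt ℂ mellinPrefactor l := by
  have htwo_pi : ((2 * π : ℝ) : ℂ) ≠ 0 := ofReal_ne_zero.2 Real.two_pi_pos.ne'
  have hgamma : DifferentiableAt ℂ Gamma l := by
    refine differentiableAt_Gamma l fun m hm => hl.not_ge ?_
    simp [hm]
  have hcpow : DifferentiableAt ℂ (fun l : ℂ => ((2 * π : ℝ) : ℂ) ^ (-l)) l :=
    differentiableAt_id.neg.const_cpow (Or.inl htwo_pi)
  exact (hcpow.const_mul _).mul hgamma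

theorem saddleAmplitude_ne_zero (η : ℂ) : saddleAmplitude η ≠ 0 :=
  mul_ne_zero (exp_ne_zero _) (exp_ne_zero _)

theorem differentiableAt_saddleAmplitude {η : ℂ} (hη : η / zeta8 ∈ slitPlane) :
    DifferentiableAt ℂ saddleAmplitude η := by
  unfold saddleAmplitude phase
  fun_prop (disch := assumption)

theorem norm_exp_two_pi_mul_I_mul (η : ℂ) : ‖exp (2 * π * I * η)‖ = Real.exp (-(2 * π * η.im)) := by
  rw [norm_exp]
  congr 1
  simp

theorem norm_exp_two_pi_mul_I_mul_lt_one {η : ℂ} (hη : 0 < η.im) : ‖exp (2 * π * I * η)‖ < 1 := by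
  rw [norm_exp_two_pi_mul_I_mul, Real.exp_lt_one_iff, neg_lt_zero]
  positivity

theorem one_sub_ne_zero_of_norm_lt_one {q : ℂ} (hq : ‖q‖ < 1) : 1 - q ≠ 0 := by
  intro h
  rw [← sub_eq_zero.1 h, norm_one] at hq
  exact hq.false

theorem one_add_sq_ne_zero_of_norm_lt_one {q : ℂ} (hq : ‖q‖ < 1) : 1 + q ^ 2 ≠ 0 := by
  have hsq : ‖-q ^ 2‖ < 1 := by
    rw [norm_neg, norm_pow]
    exact pow_lt_one₀ (norm_nonneg q) hq two_ne_zero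
  simpa only [sub_neg_eq_add] using one_sub_ne_zero_of_norm_lt_one hsq

/-- The main term for `mellin rayKernel (1 - s)`. The leading term of the series is multiplied by
the factor `(1 - q) / (1 + q²)`, `q = e^{2 π i η}`, which turns `e^{π i η}` into the trigonometric
quotient of `mainTerm`. -/
noncomputable def mainFactor (s : ℂ) : ℂ :=
  mellinPrefactor (1 - s) * (saddleAmplitude (eta s) * (exp (π * I / 8) / √2)) *
    ((1 - exp (2 * π * I * eta s)) / (1 + exp (2 * π * I * eta s) ^ 2))

section LeftHalfPlane

variable {s : ℂ} (hs : s.re < 0)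
include hs

theorem one_sub_re_pos : 0 < (1 - s).re := by
  rw [sub_re, one_re]
  linarith

theorem mainFactor_ne_zero : mainFactor s ≠ 0 := by
  have hq := norm_exp_two_pi_mul_I_mul_lt_one (eta_re_im_pos hs).2
  refine mul_ne_zero (mul_ne_zero (mellinPrefactor_ne_zero (one_sub_re_pos hs))
    (mul_ne_zero (saddleAmplitude_ne_zero _) (div_ne_zero (exp_ne_zero _) (by simp))))
    (div_ne_zero (one_sub_ne_zero_of_norm_lt_one hq) (one_add_sq_ne_zero_of_norm_lt_one hq))

theorem differentiableAt_mainFactor : DifferentiableAt ℂ mainFactor s := by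
  have heta := differentiableAt_eta hs
  have hpre : DifferentiableAt ℂ (fun s => mellinPrefactor (1 - s)) s :=
    (differentiableAt_mellinPrefactor (one_sub_re_pos hs)).comp s (by fun_prop)
  have hamp : DifferentiableAt ℂ (fun s => saddleAmplitude (eta s)) s :=
    (differentiableAt_saddleAmplitude (Or.inl (eta_div_zeta8_re_pos hs))).comp s heta
  have hq := one_add_sq_ne_zero_of_norm_lt_one
    (norm_exp_two_pi_mul_I_mul_lt_one (eta_re_im_pos hs).2)
  unfold mainFactor
  fun_prop (disch := assumption)

theorem differentiableAt_mellin_rayKernel_one_sub :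
    DifferentiableAt ℂ (fun s => mellin rayKernel (1 - s)) s := by
  refine (differentiableAt_mellin_rayKernel ?_).comp s (by fun_prop)
  rw [sub_re, one_re]
  linarith

end LeftHalfPlane

theorem zeta8_mul_cpow {p : ℂ} (hp : 0 < p.re) (w : ℂ) :
    (zeta8 * p) ^ w = exp (π * I / 4 * w) * p ^ w := by
  have hp_ne : p ≠ 0 := fun h => hp.ne' (by rw [h, zero_re])
  have hlog : log zeta8 = π * I / 4 := by
    rw [zeta8, log_exp] <;> simp <;> linarith [Real.pi_pos]
  have harg : arg zeta8 = π / 4 := by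
    rw [← log_im, hlog]
    simp
  have harg_p := abs_lt.1 (abs_arg_lt_pi_div_two_iff.2 (Or.inl hp))
  have hmul : log (zeta8 * p) = log zeta8 + log p := by
    rw [log_mul_eq_add_log_iff zeta8_ne_zero hp_ne, harg]
    exact ⟨by linarith [harg_p.1], by linarith [harg_p.2]⟩
  rw [cpow_def_of_ne_zero (mul_ne_zero zeta8_ne_zero hp_ne), hmul, hlog,
    cpow_def_of_ne_zero hp_ne, ← exp_add]
  ring_nf

theorem sin_div_two_mul_cos_eq (z : ℂ) :
    sin (π * z) / (2 * cos (2 * π * z)) = I / 2 * exp (π * I * z) *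
      ((1 - exp (2 * π * I * z)) / (1 + exp (2 * π * I * z) ^ 2)) := by
  have hsq : exp (2 * π * I * z) = exp (π * I * z) ^ 2 := by
    rw [← exp_nat_mul]; push_cast; ring_nf
  have hsin : sin (π * z) = ((exp (π * I * z))⁻¹ - exp (π * I * z)) * I / 2 := by
    rw [Complex.sin, ← exp_neg]; ring_nf
  have hcos : 2 * cos (2 * π * z) = exp (π * I * z) ^ 2 + (exp (π * I * z) ^ 2)⁻¹ := by
    rw [Complex.cos, ← hsq, ← exp_neg]; ring_nf
  rw [hsq, hsin, hcos]
  have hexp := exp_ne_zero (π * I * z)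
  generalize exp (π * I * z) = E at hexp ⊢
  have hinv : E ^ 2 + (E ^ 2)⁻¹ = (1 + (E ^ 2) ^ 2) / E ^ 2 := by field_simp; ring
  rw [hinv]
  field_simp

theorem two_cpow_mul_pi_cpow (s : ℂ) :
    (2 : ℂ) ^ s * (π : ℂ) ^ (s - 1) = 2 * (2 * π : ℝ) ^ (-(1 - s)) := by
  have htwo : (2 : ℂ) ^ s = 2 * ((2 : ℝ) : ℂ) ^ (s - 1) := by
    rw [ofReal_ofNat, cpow_sub _ _ two_ne_zero, cpow_one]
    field_simp
  rw [ofReal_mul, mul_cpow_ofReal_nonneg zero_le_two Real.pi_pos.le, neg_sub, htwo, mul_assoc]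

theorem exp_phase_one_sub_zero {s : ℂ} (hs : s.re < 0) :
    exp (phase (1 - s) 0 (eta s / zeta8)) =
      exp (π * I * (1 - s) / 4) * eta s ^ (s - 1) * exp (-(π * I * eta s ^ 2)) := by
  have hne : eta s / zeta8 ≠ 0 := slitPlane_ne_zero (Or.inl (eta_div_zeta8_re_pos hs))
  have hcpow : eta s ^ (s - 1) = exp (π * I / 4 * (s - 1)) * (eta s / zeta8) ^ (s - 1) := by
    rw [← zeta8_mul_cpow (eta_div_zeta8_re_pos hs), mul_div_cancel₀ _ zeta8_ne_zero]
  have hexp : exp (π * I * (1 - s) / 4) * exp (π * I / 4 * (s - 1)) = 1 := by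
    rw [← exp_add, ← exp_zero]
    ring_nf
  rw [exp_phase hne, hcpow, ← mul_assoc, hexp, one_mul, neg_sub, mul_zero, zero_mul, sub_zero,
    div_pow, zeta8_sq, div_I]
  ring_nf

theorem mainTerm_eq {s : ℂ} (hs : s.re < 0) : mainTerm s =
    zeta8 * exp (π * I * s / 4) * sin (π * s / 2) * mainFactor s := by
  have hsqrt : (√2 : ℂ) ^ 2 = 2 := by
    rw [← ofReal_pow, Real.sq_sqrt zero_le_two, ofReal_ofNat]
  have hsqrt_ne : (√2 : ℂ) ≠ 0 := by simp
  have hzeta8 := zeta8_ne_zero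
  have hexp : exp (π * I * s / 4) * exp (π * I * (1 - s) / 4) = zeta8 := by
    rw [zeta8, ← exp_add]
    ring_nf
  have hexp_three : exp (3 * π * I / 8) = zeta8 * exp (π * I / 8) := by
    rw [zeta8, ← exp_add]
    ring_nf
  rw [mainTerm, chi, two_cpow_mul_pi_cpow, mul_div_assoc (_ * _) (sin _),
    sin_div_two_mul_cos_eq, hexp_three, mainFactor, mellinPrefactor, saddleAmplitude,
    ← one_sub_eq, exp_phase_one_sub_zero hs]
  generalize (1 - exp (2 * π * I * eta s)) / (1 + exp (2 * π * I * eta s) ^ 2) = t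
  generalize exp (π * I * s / 4) = x at hexp ⊢
  generalize exp (π * I * (1 - s) / 4) = y at hexp ⊢
  generalize eta s ^ (s - 1) = z
  generalize exp (-(π * I * eta s ^ 2)) = g
  field_simp
  linear_combination
    (sin (s * π / 2) * Gamma (1 - s) * z * g * t) * (2 * hexp - zeta8 * hsqrt)

theorem norm_mul_sub_one_le (x y : ℂ) :
    ‖x * y - 1‖ ≤ ‖x - 1‖ + ‖y - 1‖ + ‖x - 1‖ * ‖y - 1‖ := by
  rw [← norm_mul, show x * y - 1 = x - 1 + (y - 1) + (x - 1) * (y - 1) by ring]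
  exact norm_add₃_le

theorem norm_one_add_sq_div_one_sub_sub_one_le {q : ℂ} (hq : ‖q‖ ≤ 0.01) :
    ‖(1 + q ^ 2) / (1 - q) - 1‖ ≤ 0.02 := by
  have hden : 0.99 ≤ ‖1 - q‖ := by
    have hle := norm_sub_norm_le (1 : ℂ) q
    rw [norm_one] at hle
    linarith
  have hnum : ‖q ^ 2 + q‖ ≤ ‖q‖ ^ 2 + ‖q‖ := by
    rw [← norm_pow]
    exact norm_add_le _ _
  rw [div_sub_one (one_sub_ne_zero_of_norm_lt_one (by linarith)), add_sub_sub_cancel,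
    norm_div, div_le_iff₀ (by linarith)]
  nlinarith [norm_nonneg q]

theorem norm_exp_two_pi_mul_I_mul_le {η : ℂ} (hη : 5 ≤ η.im) :
    ‖exp (2 * π * I * η)‖ ≤ 0.01 := by
  have hexp : (2 : ℝ) ^ 30 ≤ Real.exp 30 := by
    have hpow : Real.exp 30 = Real.exp 1 ^ 30 := by
      rw [← Real.exp_nat_mul]
      norm_num
    rw [hpow]
    gcongr
    linarith [Real.exp_one_gt_d9]
  calc ‖exp (2 * π * I * η)‖ ≤ Real.exp (-30) := by
        rw [norm_exp_two_pi_mul_I_mul, Real.exp_le_exp]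
        nlinarith [Real.pi_gt_three]
    _ ≤ (2 ^ 30)⁻¹ := by
        rw [Real.exp_neg]
        exact inv_anti₀ (by positivity) hexp
    _ ≤ 0.01 := by norm_num

section OnG

variable {s : ℂ} (hs : s ∈ G)
include hs

theorem norm_mellin_rayKernel_div_sub_one_le :
    ‖mellin rayKernel (1 - s) / (mellinPrefactor (1 - s) *
        (saddleAmplitude (eta s) * (exp (π * I / 8) / √2))) - 1‖ ≤ 0.66 := by
  have hpeak : 0 < ‖mellinPrefactor (1 - s) * saddleAmplitude (eta s)‖ :=
    norm_pos_iff.2 (mul_ne_zero (mellinPrefactor_ne_zero (one_sub_re_pos hs.1))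
      (saddleAmplitude_ne_zero _))
  have hphase : ‖exp (π * I / 8) / √2‖ = (√2)⁻¹ := by
    rw [show (π * I / 8 : ℂ) = (π / 8 : ℝ) * I by push_cast; ring, norm_div,
      norm_exp_ofReal_mul_I, norm_real, Real.norm_of_nonneg (Real.sqrt_nonneg 2), one_div]
  have hsqrt : √2 ≤ 1.5 := by
    rw [Real.sqrt_le_left] <;> norm_num
  have hmellin := norm_mellin_rayKernel_one_sub_sub_le hs
  rw [← mul_assoc] at hmellin ⊢
  generalize mellinPrefactor (1 - s) * saddleAmplitude (eta s) = P at hpeak hmellin ⊢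
  generalize exp (π * I / 8) / √2 = ε at hphase hmellin ⊢
  have hne : P * ε ≠ 0 := by
    rw [← norm_pos_iff, norm_mul, hphase]
    positivity
  rw [div_sub_one hne, norm_div, div_le_iff₀ (norm_pos_iff.2 hne), norm_mul, hphase]
  have hinv : 1 ≤ 1.5 * (√2)⁻¹ := by
    rwa [← div_eq_mul_inv, one_le_div (by positivity)]
  refine hmellin.trans ?_
  nlinarith

theorem norm_mellin_rayKernel_div_mainFactor_sub_one_lt :
    ‖mellin rayKernel (1 - s) / mainFactor s - 1‖ < 0.9 := by
  have hleading := norm_mellin_rayKernel_div_sub_one_le hs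
  have hq := norm_one_add_sq_div_one_sub_sub_one_le
    (norm_exp_two_pi_mul_I_mul_le (eta_bounds hs).2.1)
  rw [mainFactor, ← div_div, div_div_eq_mul_div, mul_div_assoc]
  calc _ ≤ 0.66 + 0.02 + 0.66 * 0.02 :=
        (norm_mul_sub_one_le _ _).trans (by gcongr)
    _ < 0.9 := by norm_num

theorem R_eq_mainTerm_mul :
    R s = mainTerm s * (1 + (mellin rayKernel (1 - s) / mainFactor s - 1)) := by
  have hne := mainFactor_ne_zero hs.1
  rw [R_eq_mellin (re_lt_neg_one hs), mainTerm_eq hs.1, add_sub_cancel]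
  field_simp

theorem mellin_rayKernel_one_sub_ne_zero : mellin rayKernel (1 - s) ≠ 0 := by
  intro hzero
  have hlt := norm_mellin_rayKernel_div_mainFactor_sub_one_lt hs
  norm_num [hzero] at hlt

theorem R_eq_zero_iff : R s = 0 ↔ sin (π * s / 2) = 0 := by
  simp [R_eq_mellin (re_lt_neg_one hs), zeta8_ne_zero, mellin_rayKernel_one_sub_ne_zero hs]

end OnG

theorem analyticOnNhd_of_differentiableAt_of_re_neg {f : ℂ → ℂ}
    (hf : ∀ s : ℂ, s.re < 0 → DifferentiableAt ℂ f s) : AnalyticOnNhd ℂ f {s | s.re < 0} :=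
  DifferentiableOn.analyticOnNhd (fun s hs => (hf s hs).differentiableWithinAt)
    (isOpen_lt continuous_re continuous_const)

theorem analyticOnNhd_mellin_rayKernel_div_mainFactor_sub_one :
    AnalyticOnNhd ℂ (fun s => mellin rayKernel (1 - s) / mainFactor s - 1) G :=
  (analyticOnNhd_of_differentiableAt_of_re_neg fun _ hs =>
    ((differentiableAt_mellin_rayKernel_one_sub hs).div (differentiableAt_mainFactor hs)
      (mainFactor_ne_zero hs)).sub_const 1).mono fun _ hs => hs.1

theorem sin_pi_mul_div_two_eq_zero_iff {s : ℂ} (hs : s.re < 0) :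
    sin (π * s / 2) = 0 ↔ ∃ n : ℕ, 1 ≤ n ∧ s = -2 * (n : ℂ) := by
  rw [sin_eq_zero_iff]
  constructor
  · rintro ⟨k, hk⟩
    have hs_eq : s = 2 * k := by
      apply mul_left_cancel₀ (ofReal_ne_zero.2 Real.pi_ne_zero)
      linear_combination 2 * hk
    have hk_neg : k < 0 := by
      have hre : s.re = 2 * k := by simp [hs_eq]
      exact_mod_cast (by linarith : (k : ℝ) < 0)
    obtain ⟨n, rfl⟩ := Int.exists_eq_neg_ofNat hk_neg.le
    refine ⟨n, by omega, ?_⟩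
    rw [hs_eq]
    push_cast
    ring
  · rintro ⟨n, -, rfl⟩
    exact ⟨-n, by push_cast; ring⟩

theorem analyticOrderAt_sin_pi_mul_div_two {s : ℂ} (hs : sin (π * s / 2) = 0) :
    analyticOrderAt (fun s : ℂ => sin (π * s / 2)) s = 1 := by
  have hanalytic : AnalyticAt ℂ (fun s : ℂ => sin (π * s / 2)) s := by fun_prop
  refine hanalytic.analyticOrderAt_eq_one_of_zero_deriv_ne_zero hs ?_
  have hlin : HasDerivAt (fun z : ℂ => π * z / 2) (π / 2) s := by
    simpa using ((hasDerivAt_id s).const_mul (π : ℂ)).div_const 2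
  rw [hlin.csin.deriv]
  refine mul_ne_zero (fun hcos => ?_) (by simp)
  have hsq := sin_sq_add_cos_sq (π * s / 2)
  norm_num [hs, hcos] at hsq

theorem analyticOrderAt_R {s : ℂ} (hs : s ∈ G) (hzero : R s = 0) : analyticOrderAt R s = 1 := by
  have hR : R =ᶠ[𝓝 s] (fun s : ℂ => sin (π * s / 2)) *
      fun s => zeta8 * exp (π * I * s / 4) * mellin rayKernel (1 - s) := by
    have hopen : IsOpen {z : ℂ | z.re < -1} := isOpen_lt continuous_re continuous_const
    filter_upwards [hopen.mem_nhds (re_lt_neg_one hs)] with z hz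
    rw [R_eq_mellin hz, Pi.mul_apply]
    ring
  have hmellin : AnalyticAt ℂ
      (fun s => zeta8 * exp (π * I * s / 4) * mellin rayKernel (1 - s)) s :=
    analyticOnNhd_of_differentiableAt_of_re_neg (fun z hz =>
      DifferentiableAt.mul (by fun_prop) (differentiableAt_mellin_rayKernel_one_sub hz)) s hs.1
  have hne : zeta8 * exp (π * I * s / 4) * mellin rayKernel (1 - s) ≠ 0 :=
    mul_ne_zero (mul_ne_zero zeta8_ne_zero (exp_ne_zero _)) (mellin_rayKernel_one_sub_ne_zero hs)
  rw [analyticOrderAt_congr hR, analyticOrderAt_mul (by fun_prop) hmellin,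
    analyticOrderAt_sin_pi_mul_div_two ((R_eq_zero_iff hs).1 hzero),
    hmellin.analyticOrderAt_eq_zero.2 hne, add_zero]

end RiemannAux

theorem mainTheorem1 :
    IsClosed RiemannAux.G ∧
    (∃ U : ℂ → ℂ, AnalyticOnNhd ℂ U RiemannAux.G ∧
      ∀ s ∈ RiemannAux.G, ‖U s‖ < 0.9 ∧
        RiemannAux.R s = RiemannAux.mainTerm s * (1 + U s)) ∧
    (∀ s ∈ RiemannAux.G, RiemannAux.R s = 0 ↔ ∃ n : ℕ, 1 ≤ n ∧ s = -2 * (n : ℂ)) ∧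
    (∀ s ∈ RiemannAux.G, RiemannAux.R s = 0 → analyticOrderAt RiemannAux.R s = 1) := by
  refine ⟨RiemannAux.isClosed_G,
    ⟨fun s => mellin RiemannAux.rayKernel (1 - s) / RiemannAux.mainFactor s - 1,
      RiemannAux.analyticOnNhd_mellin_rayKernel_div_mainFactor_sub_one, fun s hs =>
        ⟨RiemannAux.norm_mellin_rayKernel_div_mainFactor_sub_one_lt hs,
          RiemannAux.R_eq_mainTerm_mul hs⟩⟩,
    fun s hs => ?_, fun s hs => RiemannAux.analyticOrderAt_R hs⟩
  exact (RiemannAux.R_eq_zero_iff hs).trans (RiemannAux.sin_pi_mul_div_two_eq_zero_iff hs.1)
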